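/- Let $p$ be an odd prime and let $k,m$ be integers with $0<k<m$. Let $\upsilon_2$ denote the 2-adic valuation, put $d=\gcd(k,m)$, and suppose that $\upsilon_2(m)\ge\upsilon_2(k)+1$ (equivalently, $m/d$ is even) and $m\ne 2k$. Let $\alpha$ be a primitive element of $\mathbb{F}_{p^m}$, let $h_1$ and $h_2$ be the minimal polynomials over $\mathbb{F}_p$ of $\alpha^{-(p^k+1)}$ and $\alpha^{-1}$, and let $n=p^m-1$. Then $h_1h_2$ divides $x^n-1$, and the code $C_1$ of length $n$ over $\mathbb{F}_p$ with parity-check polynomial $h_1h_2$, i.e. the ideal of $\mathbb{F}_p[x]/(x^n-1)$ generated by $(x^n-1)/(h_1h_2)$, is cyclic of dimension $2m$. Moreover, writing $A_w$ for the number of codewords of $C_1$ of Hamming weight $w$: (1) If $\upsilon_2(m)=\upsilon_2(k)+1$, then $$\begin{aligned} A_0&=1,\\ A_{(p-1)p^{m-1}}&=(p^m-1)(1+p^{m-d}-p^{m-2d}),\\ A_{(p-1)(p^{m-1}+p^{\frac{m-2}{2}})}&=\bigl(p^{m-1}-(p-1)p^{\frac{m-2}{2}}\bigr)\tfrac{p^d(p^m-1)}{p^d+1},\\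 A_{(p-1)p^{m-1}-p^{\frac{m-2}{2}}}&=(p-1)\bigl(p^{m-1}+p^{\frac{m-2}{2}}\bigr)\tfrac{p^d(p^m-1)}{p^d+1},\\ A_{(p-1)(p^{m-1}-p^{\frac{m+2d-2}{2}})}&=\bigl(p^{m-2d-1}+(p-1)p^{\frac{m-2d-2}{2}}\bigr)\tfrac{p^m-1}{p^d+1},\\ A_{(p-1)p^{m-1}+p^{\frac{m+2d-2}{2}}}&=(p-1)\bigl(p^{m-2d-1}-p^{\frac{m-2d-2}{2}}\bigr)\tfrac{p^m-1}{p^d+1}, \end{aligned}$$ and $A_w=0$ for every other $w$. (2) If $\upsilon_2(m)>\upsilon_2(k)+1$, then $$\begin{aligned} A_0&=1,\\ A_{(p-1)p^{m-1}}&=(p^m-1)(1+p^{m-d}-p^{m-2d}),\\ A_{(p-1)(p^{m-1}-p^{\frac{m-2}{2}})}&=\bigl(p^{m-1}+(p-1)p^{\frac{m-2}{2}}\bigr)\tfrac{p^d(p^m-1)}{p^d+1},\\ A_{(p-1)p^{m-1}+p^{\frac{m-2}{2}}}&=(p-1)\bigl(p^{m-1}-p^{\frac{m-2}{2}}\bigr)\tfrac{p^d(p^m-1)}{p^d+1},\\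 A_{(p-1)(p^{m-1}+p^{\frac{m+2d-2}{2}})}&=\bigl(p^{m-2d-1}-(p-1)p^{\frac{m-2d-2}{2}}\bigr)\tfrac{p^m-1}{p^d+1},\\ A_{(p-1)p^{m-1}-p^{\frac{m+2d-2}{2}}}&=(p-1)\bigl(p^{m-2d-1}+p^{\frac{m-2d-2}{2}}\bigr)\tfrac{p^m-1}{p^d+1}, \end{aligned}$$ and $A_w=0$ for every other $w$. -/

import Mathlib

open Polynomial

noncomputable section

namespace CyclicCodes

/-- The polynomial `c₀ + c₁ X + ⋯ + cₙ₋₁ Xⁿ⁻¹` attached to a word `(c₀, …, cₙ₋₁)`. -/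
def wordPoly {K : Type*} [Field K] (n : ℕ) : (Fin n → K) →ₗ[K] K[X] where
  toFun c := ∑ i : Fin n, C (c i) * X ^ (i : ℕ)
  map_add' a b := by simp [add_mul, Finset.sum_add_distrib]
  map_smul' r a := by simp [Finset.smul_sum, smul_eq_C_mul, mul_assoc]

/-- The ring `K[X] / (Xⁿ - 1)`. -/
abbrev CyclicRing (K : Type*) [Field K] (n : ℕ) : Type _ :=
  K[X] ⧸ Ideal.span {(X ^ n - 1 : K[X])}

/-- The class in `K[X] / (Xⁿ - 1)` of the polynomial of a word. -/
def wordClass {K : Type*} [Field K] (n : ℕ) : (Fin n → K) →ₗ[K] CyclicRing K n :=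
  (Ideal.Quotient.mkₐ K (Ideal.span {(X ^ n - 1 : K[X])})).toLinearMap ∘ₗ wordPoly n

/-- The code of length `n` over `K` with generator polynomial `g`: the words whose class
lies in the ideal of `K[X] / (Xⁿ - 1)` generated by `g`. -/
def codeOfGenerator {K : Type*} [Field K] (n : ℕ) (g : K[X]) : Submodule K (Fin n → K) :=
  ((Ideal.span {Ideal.Quotient.mk (Ideal.span {(X ^ n - 1 : K[X])}) g}).restrictScalars K).comap
    (wordClass n)

/-- The code of length `n` over `K` with parity-check polynomial `h` (a divisor of `Xⁿ - 1`):
its generator polynomial is `(Xⁿ - 1) / h`. -/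
def codeOfParityCheck {K : Type*} [Field K] (n : ℕ) (h : K[X]) : Submodule K (Fin n → K) :=
  codeOfGenerator n ((X ^ n - 1) / h)

/-- The cyclic shift `(c₀, c₁, …, cₙ₋₁) ↦ (cₙ₋₁, c₀, …, cₙ₋₂)`. -/
def cyclicShift {K : Type*} {n : ℕ} (c : Fin n → K) : Fin n → K :=
  fun i => c ((finRotate n).symm i)

/-- A linear code is cyclic if it is closed under the cyclic shift. -/
def IsCyclicCode {K : Type*} [Field K] {n : ℕ} (C : Submodule K (Fin n → K)) : Prop :=
  ∀ c ∈ C, cyclicShift c ∈ C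

/-- `weightCount C w` is the number of codewords of `C` of Hamming weight `w`. The index is an
integer, so that formulas for weights contain no truncated subtraction. -/
def weightCount {K : Type*} [Field K] [DecidableEq K] {n : ℕ} (C : Submodule K (Fin n → K)) (w : ℤ) : ℕ :=
  Set.ncard {c : Fin n → K | c ∈ C ∧ (hammingNorm c : ℤ) = w}

end CyclicCodes

end

noncomputable section

namespace CyclicCodes

/-! ### Value distribution of a quadratic form over a finite field -/

section BilinearCount

variable {K V : Type*} [Field K] [AddCommGroup V] [Module K V]

/-! The codewords are the trace words `(Tr (a x ^ (p ^ k + 1) + b x))` with `x` running over the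
powers of `α`. So a weight is `|F|` minus the number of zeros of a quadratic form plus a linear
form, and the theorem is a count of pairs `(a, b)`. Put `k = d (2e + 1)` and `m = 2 d t`, and for
the form `Q_a x = Tr (a x ^ (p ^ k + 1))` let `S_a = N₀ - N₁`, where `N_c` is the number of `x` with
`Q_a x = c`. No character sums are needed, because four counts determine everything.

Scaling `x` shows that all nonzero values of `Q_a` are equally frequent. The second moment of the
`N_c` then gives `S_a ^ 2 = |rad Q_a| * |F|` (`fiberCard_sub_sq`), and for `a ≠ 0` the radical has
order `1` or `p ^ (2 d)` (`card_ker_powForm`). The roots of unity of order dividing `p ^ d + 1`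
preserve `Q_a`, so `S_a` is `1` modulo `p ^ d + 1`, which fixes its sign
(`radCard_and_fiberCard_sub`). Summing `S_a` over `a` counts the degenerate forms
(`card_radCard_eq`).

For fixed `a`, completing the square handles the linear terms in the image of the polar form. The
others are nonzero on the radical and give exactly `|F| / p` zeros (`zeroCard_distribution`).
Summing over `a` yields `pairCount_eq`. Only the pair `(0, 0)` gives the zero word, so the trace
words form a space of dimension `2 m`. This meets the degree bound for the code
(`codeOfParityCheck_eq_range`). -/

theorem card_mul_card_fiber_of_translate [Finite K] [Finite V] (φ : V → K) (z : V) (u : K)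
    (hu : u ≠ 0) (h : ∀ (x : V) (t : K), φ (x + t • z) = φ x + t * u) (c : K) :
    Nat.card K * Nat.card {x // φ x = c} = Nat.card V := by
  have hfib (c' : K) : Nat.card {x // φ x = c'} = Nat.card {x // φ x = c} := by
    refine Nat.card_congr
      { toFun := fun x => ⟨x.1 + ((c - c') / u) • z, ?_⟩
        invFun := fun x => ⟨x.1 + (-((c - c') / u)) • z, ?_⟩
        left_inv := ?_
        right_inv := ?_ }
    · rw [h, x.2]; field_simp; ring
    · rw [h, x.2]; field_simp; ring
    · intro x; ext; simp [add_assoc]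
    · intro x; ext; simp [add_assoc]
  have := Fintype.ofFinite K
  rw [← Nat.card_congr (Equiv.sigmaFiberEquiv φ), Nat.card_sigma, Finset.sum_congr rfl
    (fun c' _ => hfib c')]
  simp [Nat.card_eq_fintype_card]

theorem card_mul_card_linear_fiber [Finite K] [Finite V] (f : V →ₗ[K] K) (hf : f ≠ 0) (c : K) :
    Nat.card K * Nat.card {x // f x = c} = Nat.card V := by
  obtain ⟨z, hz⟩ : ∃ z, f z ≠ 0 := by
    by_contra! h
    exact hf (LinearMap.ext h)
  exact card_mul_card_fiber_of_translate f z (f z) hz (by simp) c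

/-- The number of `x` with `G x x = c`. -/
def fiberCard (G : V →ₗ[K] V →ₗ[K] K) (c : K) : ℕ := Nat.card {x // G x x = c}

/-- The number of zeros of `x ↦ G x x + f x`. -/
def zeroCard (G : V →ₗ[K] V →ₗ[K] K) (f : V →ₗ[K] K) : ℕ := Nat.card {x // G x x + f x = 0}

theorem sum_fiberCard [Fintype K] [Finite V] (G : V →ₗ[K] V →ₗ[K] K) :
    ∑ c, fiberCard G c = Nat.card V := by
  rw [← Nat.card_congr (Equiv.sigmaFiberEquiv fun x => G x x), Nat.card_sigma]
  rfl

theorem apply_self_eq_zero_of_mem_ker (h2 : (2 : K) ≠ 0) (G : V →ₗ[K] V →ₗ[K] K) {z : V}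
    (hz : z ∈ LinearMap.ker (G + G.flip)) : G z z = 0 := by
  have := LinearMap.congr_fun (LinearMap.mem_ker.1 hz) z
  simp only [LinearMap.add_apply, LinearMap.flip_apply, LinearMap.zero_apply] at this
  rw [← two_mul] at this
  exact (mul_eq_zero.1 this).resolve_left h2

/-- The sum of squares counts pairs `(x, x + z)` with equal values. For fixed `z` the condition is
affine in `x`: it holds for all `x` if `z` lies in the radical, and for a proportion `1 / |K|` of
them otherwise. -/
theorem sum_fiberCard_sq [Fintype K] [Finite V] (h2 : (2 : K) ≠ 0) (G : V →ₗ[K] V →ₗ[K] K) :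
    Nat.card K * ∑ c, (fiberCard G c : ℤ) ^ 2 =
      Nat.card (LinearMap.ker (G + G.flip)) * Nat.card K * Nat.card V
        + (Nat.card V - Nat.card (LinearMap.ker (G + G.flip))) * Nat.card V := by
  classical
  have := Fintype.ofFinite V
  have e : (Σ z : V, {x // G (x + z) (x + z) = G x x}) ≃
      (Σ c : K, {x // G x x = c} × {x // G x x = c}) :=
    { toFun := fun s => ⟨G s.2.1 s.2.1, ⟨s.2.1, rfl⟩, ⟨s.2.1 + s.1, s.2.2⟩⟩
      invFun := fun s => ⟨s.2.2.1 - s.2.1.1, ⟨s.2.1.1, by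
        rw [add_sub_cancel, s.2.2.2, s.2.1.2]⟩⟩
      left_inv := by
        rintro ⟨z, x, hx⟩
        have : x + z - x = z := by abel
        simp only [Sigma.mk.injEq]
        refine ⟨this, ?_⟩
        congr! 1
        simp [this]
      right_inv := by
        rintro ⟨c, ⟨x, rfl⟩, ⟨y, hy⟩⟩
        simp }
  have h1 : ∑ c, fiberCard G c ^ 2 = ∑ z : V, Nat.card {x // G (x + z) (x + z) = G x x} := by
    rw [← Nat.card_sigma, Nat.card_congr e, Nat.card_sigma]
    simp [fiberCard, sq]
  have hz (z : V) : Nat.card K * Nat.card {x // G (x + z) (x + z) = G x x} =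
      if z ∈ LinearMap.ker (G + G.flip) then Nat.card K * Nat.card V else Nat.card V := by
    have hexp (x : V) : G (x + z) (x + z) = G x x ↔ (G + G.flip) z x = - G z z := by
      simp only [map_add, LinearMap.add_apply, LinearMap.flip_apply]
      constructor <;> intro h <;> linear_combination h
    simp_rw [hexp]
    split_ifs with h
    · rw [apply_self_eq_zero_of_mem_ker h2 G h, LinearMap.mem_ker.1 h]
      simp
    · exact card_mul_card_linear_fiber _ h _
  have hr : Finset.card (Finset.univ.filter fun z => z ∈ LinearMap.ker (G + G.flip)) =
      Nat.card (LinearMap.ker (G + G.flip)) := by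
    rw [Nat.card_eq_fintype_card, Fintype.card_subtype]
  have hr' : Finset.card (Finset.univ.filter fun z => ¬ z ∈ LinearMap.ker (G + G.flip)) +
      Nat.card (LinearMap.ker (G + G.flip)) = Nat.card V := by
    rw [← hr, add_comm, Finset.card_filter_add_card_filter_not, Finset.card_univ,
      Nat.card_eq_fintype_card]
  have h3 : Nat.card K * ∑ c, fiberCard G c ^ 2 =
      Nat.card (LinearMap.ker (G + G.flip)) * (Nat.card K * Nat.card V) +
      Finset.card (Finset.univ.filter fun z => ¬ z ∈ LinearMap.ker (G + G.flip)) * Nat.card V := by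
    rw [h1, Finset.mul_sum, Finset.sum_congr rfl (fun z _ => hz z), Finset.sum_ite,
      Finset.sum_const, Finset.sum_const, hr, smul_eq_mul, smul_eq_mul]
  have h4 : ((Finset.card (Finset.univ.filter fun z => ¬ z ∈ LinearMap.ker (G + G.flip)) : ℕ) : ℤ)
      = Nat.card V - Nat.card (LinearMap.ker (G + G.flip)) := by
    rw [← hr']; push_cast; ring
  rw [← h4]
  have := congrArg (Nat.cast : ℕ → ℤ) h3
  push_cast at this ⊢
  rw [this]; ring

theorem sum_eq_of_eq_one [Fintype K] (g : K → ℤ) (hg : ∀ c, c ≠ 0 → g c = g 1) :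
    ∑ c, g c = g 0 + (Nat.card K - 1) * g 1 := by
  classical
  rw [← Finset.add_sum_erase _ _ (Finset.mem_univ (0 : K)),
    Finset.sum_congr rfl (fun c hc => hg c (Finset.ne_of_mem_erase hc)), Finset.sum_const,
    Finset.card_erase_of_mem (Finset.mem_univ _), Finset.card_univ, nsmul_eq_mul,
    Nat.cast_sub Fintype.card_pos, Nat.card_eq_fintype_card]
  simp

theorem fiberCard_zero_add [Finite K] [Finite V] (G : V →ₗ[K] V →ₗ[K] K)
    (hG : ∀ c, c ≠ 0 → fiberCard G c = fiberCard G 1) :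
    (fiberCard G 0 + (Nat.card K - 1) * fiberCard G 1 : ℤ) = Nat.card V := by
  have := Fintype.ofFinite K
  rw [← sum_fiberCard G, Nat.cast_sum,
    sum_eq_of_eq_one (fun c => (fiberCard G c : ℤ)) (fun c hc => by rw [hG c hc])]

/-- The analogue of the absolute value of a Gauss sum. Substituting the first moment `N₀ + (|K| - 1)
N₁ = |V|` into the second moment leaves a common factor `|K| - 1`, which is cancelled. -/
theorem fiberCard_sub_sq [Finite K] [Finite V] (h2 : (2 : K) ≠ 0) (G : V →ₗ[K] V →ₗ[K] K)
    (hG : ∀ c, c ≠ 0 → fiberCard G c = fiberCard G 1) :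
    ((fiberCard G 0 : ℤ) - fiberCard G 1) ^ 2 =
      Nat.card (LinearMap.ker (G + G.flip)) * Nat.card V := by
  have := Fintype.ofFinite K
  have h1 := fiberCard_zero_add G hG
  have h3 := sum_fiberCard_sq h2 G
  rw [sum_eq_of_eq_one (fun c => (fiberCard G c : ℤ) ^ 2) (fun c hc => by rw [hG c hc])] at h3
  have hK : ((Nat.card K : ℤ) - 1) ≠ 0 := by
    have : 1 < Nat.card K := Finite.one_lt_card
    omega
  apply mul_left_cancel₀ hK
  rw [← h1] at h3 ⊢
  linear_combination h3

/-- Completing the square: the linear term is absorbed by the translation `x ↦ x + y`, at the cost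
of the constant `G y y`. -/
theorem zeroCard_add_flip [Finite V] (G : V →ₗ[K] V →ₗ[K] K) (y : V) :
    zeroCard G ((G + G.flip) y) = fiberCard G (G y y) := by
  refine Nat.card_congr ((Equiv.addRight y).subtypeEquiv fun x => ?_)
  simp only [Equiv.coe_addRight, map_add, LinearMap.add_apply, LinearMap.flip_apply]
  constructor <;> intro h <;> linear_combination h

/-- The image of a symmetric polar form is the annihilator of its radical. Hence `f` is nonzero at
some radical vector `z`, and moving along `z` runs uniformly through all values. -/
theorem card_mul_zeroCard_of_notMem_range [Finite K] [Finite V] (h2 : (2 : K) ≠ 0)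
    (G : V →ₗ[K] V →ₗ[K] K) (f : V →ₗ[K] K) (hf : f ∉ LinearMap.range (G + G.flip)) :
    Nat.card K * zeroCard G f = Nat.card V := by
  obtain ⟨z, hz, hfz⟩ : ∃ z ∈ LinearMap.ker (G + G.flip), f z ≠ 0 := by
    by_contra! h
    apply hf
    have hle : LinearMap.range (G + G.flip) ≤
        (LinearMap.ker (G + G.flip)).dualAnnihilator := by
      rintro _ ⟨y, rfl⟩
      rw [Submodule.mem_dualAnnihilator]
      intro w hw
      have := LinearMap.congr_fun (LinearMap.mem_ker.1 hw) y
      simp only [LinearMap.add_apply, LinearMap.flip_apply, LinearMap.zero_apply] at this ⊢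
      rw [add_comm]; exact this
    have heq : LinearMap.range (G + G.flip) =
        (LinearMap.ker (G + G.flip)).dualAnnihilator := by
      apply Submodule.eq_of_le_of_finrank_eq hle
      have h1 := LinearMap.finrank_range_add_finrank_ker (G + G.flip)
      have h2 := Subspace.finrank_add_finrank_dualAnnihilator_eq (LinearMap.ker (G + G.flip))
      exact Nat.add_right_cancel (h1.trans ((add_comm _ _).trans h2).symm)
    rw [heq, Submodule.mem_dualAnnihilator]
    exact h
  refine card_mul_card_fiber_of_translate (fun x => G x x + f x) z (f z) hfz (fun x t => ?_) 0
  have h0 := apply_self_eq_zero_of_mem_ker h2 G hz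
  have h1 := LinearMap.congr_fun (LinearMap.mem_ker.1 hz) x
  simp only [LinearMap.add_apply, LinearMap.flip_apply, LinearMap.zero_apply] at h1
  simp only [map_add, map_smul, LinearMap.add_apply, LinearMap.smul_apply, smul_eq_mul]
  linear_combination t * t * h0 + t * h1

/-- The set `S` is a union of fibres of `B`, and each nonempty fibre is a coset of the kernel. -/
theorem card_ker_mul_card_image {W : Type*} [AddCommGroup W] [Module K W] [Finite V] [Finite W]
    (B : V →ₗ[K] W) (S : V → Prop) :
    (∀ x y, B x = B y → S x → S y) →
    Nat.card (LinearMap.ker B) * Nat.card {f // ∃ y, B y = f ∧ S y} = Nat.card {y // S y} := by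
  intro hS
  have e : {y // S y} ≃ Σ f : {f // ∃ y, B y = f ∧ S y}, {y // B y = f.1} :=
    { toFun := fun y => ⟨⟨B y.1, y.1, rfl, y.2⟩, ⟨y.1, rfl⟩⟩
      invFun := fun s => ⟨s.2.1, by
        obtain ⟨⟨f, x, hx, hSx⟩, y, hy⟩ := s
        exact hS x y (hx.trans hy.symm) hSx⟩
      left_inv := fun y => rfl
      right_inv := by
        rintro ⟨⟨f, hf⟩, y, hy⟩
        obtain rfl : B y = f := hy
        rfl }
  have := Fintype.ofFinite {f // ∃ y, B y = f ∧ S y}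
  rw [Nat.card_congr e, Nat.card_sigma]
  have hf (f : {f // ∃ y, B y = f ∧ S y}) :
      Nat.card {y // B y = f.1} = Nat.card (LinearMap.ker B) := by
    obtain ⟨f, x, rfl, hSx⟩ := f
    refine Nat.card_congr ((Equiv.subRight x).subtypeEquiv fun y => ?_)
    simp [sub_eq_zero]
  rw [Finset.sum_congr rfl (fun f _ => hf f), Finset.sum_const, smul_eq_mul, Finset.card_univ,
    Nat.card_eq_fintype_card (α := {f // ∃ y, B y = f ∧ S y}), mul_comm]

theorem apply_self_congr (h2 : (2 : K) ≠ 0) (G : V →ₗ[K] V →ₗ[K] K) {x y : V}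
    (h : (G + G.flip) x = (G + G.flip) y) : G x x = G y y := by
  have h1 : y - x ∈ LinearMap.ker (G + G.flip) := by
    rw [LinearMap.mem_ker, map_sub, h, sub_self]
  have h0 := apply_self_eq_zero_of_mem_ker h2 G h1
  have h3 := LinearMap.congr_fun (LinearMap.mem_ker.1 h1) x
  simp only [map_sub, LinearMap.add_apply, LinearMap.sub_apply, LinearMap.flip_apply,
    LinearMap.zero_apply] at h0 h3
  linear_combination - h0 - h3

/-- Distribution of `zeroCard G f` over all functionals `f`, when the nonzero values of
`x ↦ G x x` are equidistributed. -/
theorem zeroCard_distribution [Finite K] [Finite V] (h2 : (2 : K) ≠ 0) (G : V →ₗ[K] V →ₗ[K] K)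
    (hG : ∀ c, c ≠ 0 → fiberCard G c = fiberCard G 1) (q : ℕ) (hq : Nat.card K * q = Nat.card V)
    (h01 : fiberCard G 0 ≠ fiberCard G 1) (h0q : fiberCard G 0 ≠ q) (h1q : fiberCard G 1 ≠ q) :
    (∀ f, zeroCard G f = fiberCard G 0 ∨ zeroCard G f = fiberCard G 1 ∨ zeroCard G f = q) ∧
    Nat.card (LinearMap.ker (G + G.flip)) * Nat.card {f // zeroCard G f = fiberCard G 0} =
      fiberCard G 0 ∧
    Nat.card (LinearMap.ker (G + G.flip)) * Nat.card {f // zeroCard G f = fiberCard G 1}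
      + fiberCard G 0 = Nat.card V ∧
    Nat.card {f // zeroCard G f = fiberCard G 0} + Nat.card {f // zeroCard G f = fiberCard G 1} +
      Nat.card {f // zeroCard G f = q} = Nat.card V := by
  classical
  have hKpos : 0 < Nat.card K := Nat.card_pos
  have hnot (f) (hf : f ∉ LinearMap.range (G + G.flip)) : zeroCard G f = q := by
    have := card_mul_zeroCard_of_notMem_range h2 G f hf
    exact Nat.eq_of_mul_eq_mul_left hKpos (this.trans hq.symm)
  have hval (y : V) : zeroCard G ((G + G.flip) y) =
      if G y y = 0 then fiberCard G 0 else fiberCard G 1 := by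
    rw [zeroCard_add_flip]
    split_ifs with h
    · rw [h]
    · exact hG _ h
  have hiff0 (f) : zeroCard G f = fiberCard G 0 ↔ ∃ y, (G + G.flip) y = f ∧ G y y = 0 := by
    constructor
    · intro h
      by_cases hf : f ∈ LinearMap.range (G + G.flip)
      · obtain ⟨y, rfl⟩ := hf
        refine ⟨y, rfl, ?_⟩
        by_contra h'
        rw [hval, if_neg h'] at h
        exact h01 h.symm
      · exact absurd (h.symm.trans (hnot f hf)) h0q
    · rintro ⟨y, rfl, hy⟩
      rw [hval, if_pos hy]
  have hiff1 (f) : zeroCard G f = fiberCard G 1 ↔ ∃ y, (G + G.flip) y = f ∧ G y y ≠ 0 := by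
    constructor
    · intro h
      by_cases hf : f ∈ LinearMap.range (G + G.flip)
      · obtain ⟨y, rfl⟩ := hf
        refine ⟨y, rfl, ?_⟩
        intro h'
        rw [hval, if_pos h'] at h
        exact h01 h
      · exact absurd (h.symm.trans (hnot f hf)) h1q
    · rintro ⟨y, rfl, hy⟩
      rw [hval, if_neg hy]
  have htri (f) : zeroCard G f = fiberCard G 0 ∨ zeroCard G f = fiberCard G 1 ∨
      zeroCard G f = q := by
    by_cases hf : f ∈ LinearMap.range (G + G.flip)
    · obtain ⟨y, rfl⟩ := hf
      rw [hval]
      split_ifs <;> simp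
    · exact Or.inr (Or.inr (hnot f hf))
  have : Finite (V →ₗ[K] K) := Module.finite_of_finite K
  have := Fintype.ofFinite (V →ₗ[K] K)
  have := Fintype.ofFinite V
  refine ⟨htri, ?_, ?_, ?_⟩
  · simp_rw [hiff0]
    exact card_ker_mul_card_image (G + G.flip) (fun y => G y y = 0)
      (fun x y h hx => (apply_self_congr h2 G h).symm.trans hx)
  · simp_rw [hiff1]
    rw [card_ker_mul_card_image (G + G.flip) (fun y => G y y ≠ 0)
      (fun x y h hx => by rwa [← apply_self_congr h2 G h]), fiberCard, add_comm]
    simp only [Nat.card_eq_fintype_card, Fintype.card_subtype]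
    rw [Finset.card_filter_add_card_filter_not, Finset.card_univ]
  · have hdual : Nat.card (V →ₗ[K] K) = Nat.card V := by
      rw [Module.natCard_eq_pow_finrank (K := K) (V := V),
        Module.natCard_eq_pow_finrank (K := K) (V := V →ₗ[K] K)]
      congr 1
      exact Subspace.dual_finrank_eq
    rw [← hdual]
    simp only [Nat.card_eq_fintype_card, Fintype.card_subtype]
    rw [← Finset.card_union_of_disjoint, ← Finset.card_union_of_disjoint, ← Finset.card_univ]
    · congr 1
      ext f
      have := htri f
      simp only [Finset.mem_union, Finset.mem_filter, Finset.mem_univ, true_and, iff_true]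
      tauto
    · rw [Finset.disjoint_left]
      intro f
      simp only [Finset.mem_union, Finset.mem_filter, Finset.mem_univ, true_and]
      omega
    · rw [Finset.disjoint_left]
      intro f
      simp only [Finset.mem_filter, Finset.mem_univ, true_and]
      omega

end BilinearCount

/-! ### The forms `Tr (a x ^ (p ^ k + 1))` -/

section FiniteField

theorem card_subtype_eq_card_units {F : Type*} [Field F] [Finite F] (P : F → Prop)
    [Decidable (P 0)] :
    Nat.card {x // P x} = Nat.card {u : Fˣ // P u} + if P 0 then 1 else 0 := by
  classical
  have := Fintype.ofFinite F
  have e : {u : Fˣ // P u} ≃ {x : F // P x ∧ x ≠ 0} :=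
    { toFun := fun u => ⟨u.1, u.2, u.1.ne_zero⟩
      invFun := fun x => ⟨Units.mk0 x.1 x.2.2, x.2.1⟩
      left_inv := fun u => by ext; rfl
      right_inv := fun x => rfl }
  rw [Nat.card_congr e]
  simp only [Nat.card_eq_fintype_card, Fintype.card_subtype]
  rw [← Finset.card_filter_add_card_filter_not (s := Finset.univ.filter fun x => P x)
    (fun x => x ≠ 0), Finset.filter_filter, Finset.filter_filter]
  congr 1
  split_ifs with h
  · rw [Finset.card_eq_one]
    refine ⟨0, ?_⟩
    ext x
    simp only [Finset.mem_filter, Finset.mem_univ, true_and, Finset.mem_singleton, not_not]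
    exact ⟨fun h => h.2, fun h' => ⟨h' ▸ h, h'⟩⟩
  · rw [Finset.card_eq_zero]
    ext x
    simp only [Finset.mem_filter, Finset.mem_univ, true_and, not_not]
    simp only [Finset.notMem_empty, iff_false, not_and]
    rintro h1 rfl
    exact h h1

theorem card_units_pow_eq_one {F : Type*} [Field F] [Finite F] (j : ℕ) :
    Nat.card {u : Fˣ // u ^ j = 1} = (Nat.card F - 1).gcd j := by
  rw [← Nat.card_units, ← IsCyclic.card_powMonoidHom_ker]
  rfl

/-- The set `T` is a union of cosets of the group of `j`-th roots of unity, which has order exactly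
`j` because `j` divides `|F| - 1`. -/
theorem dvd_card_of_pow_eq_one_mul {F : Type*} [Field F] [Finite F] (j : ℕ)
    (hj : j ∣ Nat.card F - 1) (T : Fˣ → Prop) (hT : ∀ u t, u ^ j = 1 → T t → T (t * u)) :
    j ∣ Nat.card {t // T t} := by
  set H : Subgroup Fˣ := (powMonoidHom j : Fˣ →* Fˣ).ker with hH
  have hcard : Nat.card H = j := by
    rw [hH, IsCyclic.card_powMonoidHom_ker, Nat.card_units, Nat.gcd_eq_right hj]
  have hpre : {t | T t} = QuotientGroup.mk ⁻¹' ((QuotientGroup.mk : Fˣ → Fˣ ⧸ H) '' {t | T t}) := by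
    refine Set.Subset.antisymm (Set.subset_preimage_image _ _) ?_
    rintro t ⟨s, hs, hst⟩
    have hmem : s⁻¹ * t ∈ H := QuotientGroup.eq.1 hst
    have := hT (s⁻¹ * t) s hmem hs
    rwa [mul_inv_cancel_left] at this
  have : Nat.card {t // T t} =
      Nat.card (H × ((QuotientGroup.mk : Fˣ → Fˣ ⧸ H) '' {t | T t})) := by
    rw [← Nat.card_congr (QuotientGroup.preimageMkEquivSubgroupProdSet H _), ← hpre]
    rfl
  rw [this, Nat.card_prod, hcard]
  exact dvd_mul_right _ _

theorem frobeniusAlgHom_pow_apply {p : ℕ} [Fact p.Prime] {F : Type*} [Field F]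
    [Algebra (ZMod p) F] (k : ℕ) (x : F) :
    (FiniteField.frobeniusAlgHom (ZMod p) F ^ k) x = x ^ p ^ k := by
  rw [AlgHom.coe_pow, FiniteField.coe_frobeniusAlgHom, pow_iterate, ZMod.card]

theorem card_pow_eq_self {p : ℕ} [Fact p.Prime] {F : Type*} [Field F] [Finite F]
    {m j : ℕ} (hF : Nat.card F = p ^ m) :
    Nat.card {u : F // u ^ p ^ j = u} = p ^ m.gcd j := by
  classical
  have hp : 0 < p := (Fact.out : p.Prime).pos
  rw [card_subtype_eq_card_units, if_pos (zero_pow (pow_pos hp _).ne')]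
  have : Nat.card {u : Fˣ // (u : F) ^ p ^ j = u} = Nat.card {u : Fˣ // u ^ (p ^ j - 1) = 1} := by
    refine Nat.card_congr (Equiv.subtypeEquivRight fun u => ?_)
    rw [← Units.val_pow_eq_pow_val, Units.val_inj]
    obtain ⟨N, hN⟩ : ∃ N, p ^ j = N + 1 := ⟨p ^ j - 1, (Nat.sub_add_cancel (pow_pos hp _)).symm⟩
    rw [hN, Nat.add_sub_cancel, pow_succ]
    simp
  rw [this, card_units_pow_eq_one, hF, Nat.pow_sub_one_gcd_pow_sub_one,
    Nat.sub_add_cancel (pow_pos hp _)]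

variable {p : ℕ} [Fact p.Prime] {F : Type*} [Field F] [Algebra (ZMod p) F] [Finite F]

theorem trace_pow_prime_pow (k : ℕ) (x : F) :
    Algebra.trace (ZMod p) F (x ^ p ^ k) = Algebra.trace (ZMod p) F x := by
  induction k generalizing x with
  | zero => simp
  | succ k ih =>
    rw [pow_succ, pow_mul]
    rw [← ih x, ← Algebra.trace_eq_of_algEquiv
      (FiniteField.frobeniusAlgEquivOfAlgebraic (ZMod p) F) (x ^ p ^ k)]
    simp

/-- The bilinear form `(x, y) ↦ Tr (a x ^ (p ^ k) y)`. -/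
def powForm (p : ℕ) [Fact p.Prime] {F : Type*} [Field F] [Algebra (ZMod p) F] (k : ℕ) (a : F) :
    F →ₗ[ZMod p] F →ₗ[ZMod p] ZMod p :=
  LinearMap.comp (Algebra.traceForm (ZMod p) F)
    ((LinearMap.mulLeft (ZMod p) a).comp (FiniteField.frobeniusAlgHom (ZMod p) F ^ k).toLinearMap)

theorem powForm_apply {p : ℕ} [Fact p.Prime] {F : Type*} [Field F] [Algebra (ZMod p) F]
    (k : ℕ) (a x y : F) :
    powForm p k a x y = Algebra.trace (ZMod p) F (a * x ^ p ^ k * y) := by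
  rw [← frobeniusAlgHom_pow_apply (p := p) k x]
  simp [powForm, Algebra.traceForm_apply]

theorem powForm_self {p : ℕ} [Fact p.Prime] {F : Type*} [Field F] [Algebra (ZMod p) F]
    (k : ℕ) (a x : F) :
    powForm p k a x x = Algebra.trace (ZMod p) F (a * x ^ (p ^ k + 1)) := by
  rw [powForm_apply, pow_succ, mul_assoc]

theorem eq_zero_of_trace_mul_eq_zero (w : F)
    (h : ∀ x, Algebra.trace (ZMod p) F (w * x) = 0) : w = 0 :=
  (traceForm_nondegenerate (ZMod p) F).1 w h

/-- Raising the argument of one trace to the power `p ^ k` brings both terms to the shape `Tr (· * x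
^ p ^ k)`. Since `x ↦ x ^ p ^ k` is onto, nondegeneracy of the trace form applies. -/
theorem mem_ker_powForm_iff (k : ℕ) (a z : F) :
    z ∈ LinearMap.ker (powForm p k a + (powForm p k a).flip) ↔
      a * z + a ^ p ^ k * z ^ p ^ (2 * k) = 0 := by
  have hform (x : F) : (powForm p k a + (powForm p k a).flip) z x =
      Algebra.trace (ZMod p) F ((a * z + a ^ p ^ k * z ^ p ^ (2 * k)) * x ^ p ^ k) := by
    rw [LinearMap.add_apply, LinearMap.add_apply, LinearMap.flip_apply, powForm_apply,
      powForm_apply, ← trace_pow_prime_pow k (a * z ^ p ^ k * x), ← map_add]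
    congr 1
    rw [mul_pow, mul_pow, ← pow_mul, ← pow_add, two_mul]
    ring
  constructor
  · intro h
    apply eq_zero_of_trace_mul_eq_zero (p := p)
    intro x
    obtain ⟨y, rfl⟩ : ∃ y : F, y ^ p ^ k = x := by
      have := Finite.surjective_of_injective
        (FiniteField.frobeniusAlgHom (ZMod p) F ^ k).toRingHom.injective
      obtain ⟨y, hy⟩ := this x
      exact ⟨y, by rw [← hy]; exact (frobeniusAlgHom_pow_apply k y).symm⟩
    rw [← hform]
    exact LinearMap.congr_fun (LinearMap.mem_ker.1 h) y
  · intro h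
    rw [LinearMap.mem_ker]
    ext x
    rw [hform, h]
    simp

/-- The ratio `u` of two nonzero solutions of the radical equation satisfies `u ^ p ^ (2 * k) = u`.
So the radical is zero or a line over the subfield of order `p ^ gcd(m, 2k)`. -/
theorem card_ker_powForm {m k : ℕ} (hF : Nat.card F = p ^ m) {a : F} (ha : a ≠ 0) :
    Nat.card (LinearMap.ker (powForm p k a + (powForm p k a).flip)) = 1 ∨
    Nat.card (LinearMap.ker (powForm p k a + (powForm p k a).flip)) =
      p ^ m.gcd (2 * k) := by
  by_cases h : ∃ z ∈ LinearMap.ker (powForm p k a + (powForm p k a).flip), z ≠ 0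
  · right
    obtain ⟨z, hz, hz0⟩ := h
    rw [mem_ker_powForm_iff] at hz
    rw [← card_pow_eq_self hF]
    symm
    refine Nat.card_congr ((Equiv.mulRight₀ z hz0).subtypeEquiv fun u => ?_)
    rw [mem_ker_powForm_iff, Equiv.mulRight₀_apply, mul_pow]
    have : a * (u * z) + a ^ p ^ k * (u ^ p ^ (2 * k) * z ^ p ^ (2 * k)) =
        a * z * (u - u ^ p ^ (2 * k)) := by linear_combination u ^ p ^ (2 * k) * hz
    rw [this, mul_eq_zero, sub_eq_zero]
    simp only [mul_eq_zero, ha, hz0, or_self, false_or]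
    exact eq_comm
  · left
    push Not at h
    rw [(Submodule.eq_bot_iff _).2 h]
    simp

/-- On the subfield of order `p ^ (2 d)` the exponent acts as `p ^ d + 1`, which is the norm to the
subfield of order `p ^ d`. That norm is onto and its target contains the prime field. The argument
is carried out on exponents of a generator. -/
theorem exists_pow_eq_algebraMap {d e t : ℕ} (hF : Nat.card F = p ^ (2 * d * t))
    (c : ZMod p) (hc : c ≠ 0) :
    ∃ y : F, y ≠ 0 ∧ y ^ (p ^ (d * (2 * e + 1)) + 1) = algebraMap (ZMod p) F c := by
  have hp : 1 < p := (Fact.out : p.Prime).one_lt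
  obtain ⟨g, hg⟩ := IsCyclic.exists_generator (α := Fˣ)
  set c' : Fˣ := Units.map (algebraMap (ZMod p) F).toMonoidHom (Units.mk0 c hc) with hc'
  obtain ⟨i, hi⟩ := (Submonoid.mem_powers_iff _ _).1 (mem_powers_iff_mem_zpowers.2 (hg c'))
  have hord : orderOf g = p ^ (2 * d * t) - 1 := by
    rw [orderOf_eq_card_of_forall_mem_zpowers hg, Nat.card_units, hF]
  have hc1 : c' ^ (p - 1) = 1 := by
    rw [hc', ← map_pow, ZMod.units_pow_card_sub_one_eq_one, map_one]
  obtain ⟨M', hM'⟩ : p ^ (2 * d) - 1 ∣ p ^ (2 * d * t) - 1 := by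
    rw [pow_mul p (2 * d)]; exact Nat.sub_one_dvd_pow_sub_one _ _
  obtain ⟨M'', hM''⟩ : p - 1 ∣ p ^ d - 1 := Nat.sub_one_dvd_pow_sub_one _ _
  have hsq : p ^ (2 * d) - 1 = (p ^ d + 1) * (p ^ d - 1) := by
    rw [mul_comm 2 d, pow_mul, ← Nat.sq_sub_sq, one_pow]
  rw [← hi, ← pow_mul, ← orderOf_dvd_iff_pow_eq_one, hord] at hc1
  obtain ⟨s, hs⟩ := hc1
  have hi' : i = M' * M'' * s * (p ^ d + 1) := by
    apply Nat.eq_of_mul_eq_mul_right (Nat.sub_pos_of_lt hp)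
    rw [hs, hM', hsq, hM'']; ring
  have hy1 : (g ^ (M' * M'' * s)) ^ (p ^ (2 * d) - 1) = 1 := by
    rw [← pow_mul, ← orderOf_dvd_iff_pow_eq_one, hord, hM']
    exact ⟨M'' * s, by ring⟩
  refine ⟨((g ^ (M' * M'' * s) : Fˣ) : F), Units.ne_zero _, ?_⟩
  have : (g ^ (M' * M'' * s)) ^ (p ^ (d * (2 * e + 1)) + 1) = c' := by
    obtain ⟨N, hN⟩ : p ^ (2 * d) - 1 ∣ p ^ (2 * d * e) - 1 := by
      rw [pow_mul p (2 * d)]; exact Nat.sub_one_dvd_pow_sub_one _ _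
    -- Since `k = 2de + d`, the exponent is congruent to `p ^ d + 1` modulo `p ^ (2 d) - 1`.
    have hexp : p ^ (d * (2 * e + 1)) + 1 = (p ^ (2 * d) - 1) * (N * p ^ d) + (p ^ d + 1) := by
      rw [← mul_assoc, ← hN, Nat.sub_mul, one_mul, ← pow_add, ← add_assoc, Nat.sub_add_cancel]
      · congr 2; ring
      · exact Nat.pow_le_pow_right (by omega) (by omega)
    rw [hexp, pow_add, pow_mul, hy1, one_pow, one_mul, ← pow_mul, ← hi', hi]
  rw [← Units.val_pow_eq_pow_val, this]
  rfl

theorem fiberCard_powForm_eq {d e t : ℕ} (hF : Nat.card F = p ^ (2 * d * t)) (a : F)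
    (c : ZMod p) (hc : c ≠ 0) :
    fiberCard (powForm p (d * (2 * e + 1)) a) c =
      fiberCard (powForm p (d * (2 * e + 1)) a) 1 := by
  obtain ⟨y, hy0, hy⟩ := exists_pow_eq_algebraMap (e := e) hF c hc
  symm
  refine Nat.card_congr ((Equiv.mulRight₀ y hy0).subtypeEquiv fun x => ?_)
  rw [powForm_self, powForm_self, Equiv.mulRight₀_apply, mul_pow, hy]
  have : a * (x ^ (p ^ (d * (2 * e + 1)) + 1) * algebraMap (ZMod p) F c) =
      c • (a * x ^ (p ^ (d * (2 * e + 1)) + 1)) := by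
    rw [Algebra.smul_def]; ring
  rw [this, map_smul, smul_eq_mul]
  simp [hc]

theorem prime_pow_add_one_dvd {d t : ℕ} (p : ℕ) : p ^ d + 1 ∣ p ^ (2 * d * t) - 1 := by
  have h1 : p ^ d + 1 ∣ p ^ (2 * d) - 1 := by
    rw [mul_comm 2 d, pow_mul, ← one_pow 2, Nat.sq_sub_sq, one_pow]
    exact dvd_mul_right _ _
  exact h1.trans (by rw [pow_mul p (2 * d)]; exact Nat.sub_one_dvd_pow_sub_one _ _)

/-- As `k / d` is odd, `p ^ d + 1` divides `p ^ k + 1`. Multiplication by a `(p ^ d + 1)`-th root of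
unity therefore preserves the form, and the nonzero points of each fibre fall into orbits of size `p
^ d + 1`. The `- 1` removes `x = 0`, which lies only in the fibre over `0`. -/
theorem dvd_fiberCard_sub_sub_one {d e t : ℕ} (hF : Nat.card F = p ^ (2 * d * t)) (a : F) :
    (p ^ d + 1 : ℤ) ∣ (fiberCard (powForm p (d * (2 * e + 1)) a) 0 : ℤ) -
      fiberCard (powForm p (d * (2 * e + 1)) a) 1 - 1 := by
  classical
  have key (c : ZMod p) : p ^ d + 1 ∣
      Nat.card {u : Fˣ // powForm p (d * (2 * e + 1)) a u u = c} := by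
    apply dvd_card_of_pow_eq_one_mul
    · rw [hF]; exact prime_pow_add_one_dvd p
    · intro u t hu ht
      obtain ⟨N, hN⟩ : p ^ d + 1 ∣ p ^ (d * (2 * e + 1)) + 1 := by
        have := Odd.nat_add_dvd_pow_add_pow (p ^ d) 1 (n := 2 * e + 1) ⟨e, rfl⟩
        rwa [one_pow, ← pow_mul] at this
      have hu' : u ^ (p ^ (d * (2 * e + 1)) + 1) = 1 := by rw [hN, pow_mul, hu, one_pow]
      rw [powForm_self] at ht ⊢
      rw [← Units.val_pow_eq_pow_val, mul_pow, hu', mul_one, Units.val_pow_eq_pow_val, ht]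
  have h0 := card_subtype_eq_card_units
    (fun x : F => powForm p (d * (2 * e + 1)) a x x = 0)
  have h1 := card_subtype_eq_card_units
    (fun x : F => powForm p (d * (2 * e + 1)) a x x = 1)
  rw [if_pos (by simp)] at h0
  rw [if_neg (by simp)] at h1
  obtain ⟨A, hA⟩ := key 0
  obtain ⟨B, hB⟩ := key 1
  rw [hA] at h0
  rw [hB] at h1
  refine ⟨A - B, ?_⟩
  rw [fiberCard, fiberCard, h0, h1]
  push_cast
  ring

theorem trace_comp_mulRight_ne_zero {x : F} (hx : x ≠ 0) :
    (Algebra.trace (ZMod p) F).comp (LinearMap.mulRight (ZMod p) x) ≠ 0 := by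
  intro h
  apply hx
  apply eq_zero_of_trace_mul_eq_zero (p := p)
  intro y
  have := LinearMap.congr_fun h y
  simpa [mul_comm] using this

/-- Exchange the sums: for `x ≠ 0` the value is a nonzero linear functional of `a`, while `x = 0`
contributes only when `c = 0`. -/
theorem sum_fiberCard_powForm [Fintype F] (k : ℕ) (c : ZMod p) :
    p * ∑ a : F, fiberCard (powForm p k a) c =
      (Nat.card F - 1) * Nat.card F + if c = 0 then p * Nat.card F else 0 := by
  classical
  have hswap : ∑ a : F, fiberCard (powForm p k a) c =
      ∑ x : F, Nat.card {a : F // powForm p k a x x = c} := by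
    simp only [fiberCard, Nat.card_eq_fintype_card, Fintype.card_subtype, Finset.card_filter]
    exact Finset.sum_comm
  have hx (x : F) (hx : x ≠ 0) : p * Nat.card {a : F // powForm p k a x x = c} =
      Nat.card F := by
    have := card_mul_card_linear_fiber _
      (trace_comp_mulRight_ne_zero (p := p) (pow_ne_zero (p ^ k + 1) hx)) c
    rw [Nat.card_zmod] at this
    simp_rw [powForm_self]
    exact this
  rw [hswap, Finset.mul_sum, ← Finset.sum_erase_add _ _ (Finset.mem_univ (0 : F)),
    Finset.sum_congr rfl (fun x h => hx x (Finset.ne_of_mem_erase h)), Finset.sum_const,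
    Finset.card_erase_of_mem (Finset.mem_univ _), Finset.card_univ, smul_eq_mul,
    Nat.card_eq_fintype_card]
  congr 1
  split_ifs with h
  · subst h
    simp
  · have : ¬ (0 = c) := fun h' => h h'.symm
    simp [this]

theorem sum_fiberCard_sub [Fintype F] (k : ℕ) :
    ∑ a : F, ((fiberCard (powForm p k a) 0 : ℤ) - fiberCard (powForm p k a) 1) =
      Nat.card F := by
  have hp : (p : ℤ) ≠ 0 := by exact_mod_cast (Fact.out : p.Prime).ne_zero
  have h0 := sum_fiberCard_powForm (p := p) (F := F) k 0
  have h1 := sum_fiberCard_powForm (p := p) (F := F) k 1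
  rw [if_pos rfl] at h0
  rw [if_neg one_ne_zero] at h1
  rw [Finset.sum_sub_distrib, ← Nat.cast_sum, ← Nat.cast_sum]
  apply mul_left_cancel₀ hp
  rw [mul_sub]
  have h2 : p * ∑ a : F, fiberCard (powForm p k a) 0 =
      p * ∑ a : F, fiberCard (powForm p k a) 1 + p * Nat.card F := by omega
  have := congrArg (Nat.cast : ℕ → ℤ) h2
  push_cast at this ⊢
  linarith

theorem fiberCard_powForm_zero (k : ℕ) :
    fiberCard (powForm p k (0 : F)) 0 = Nat.card F ∧
    fiberCard (powForm p k (0 : F)) 1 = 0 := by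
  simp [fiberCard, powForm_self]

end FiniteField

/-! ### The sign of `N₀ - N₁` and the number of degenerate forms -/

section PowFormClassification

theorem eq_sign_of_dvd {D R S : ℤ} {t : ℕ} (hD : 2 < D) (hR : D ∣ R - (-1) ^ t)
    (hS : D ∣ S - 1) (hSR : S ^ 2 = R ^ 2) : S = (-1) ^ t * R := by
  have hnot : ¬ D ∣ 2 := fun h => absurd (Int.le_of_dvd (by norm_num) h) (by omega)
  rcases neg_one_pow_eq_or ℤ t with ht | ht <;> rw [ht] at hR ⊢ <;>
    rcases sq_eq_sq_iff_eq_or_eq_neg.1 hSR with rfl | rfl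
  · ring
  · refine absurd ?_ hnot
    have := dvd_add hR hS
    rwa [show R - 1 + (-R - 1) = -2 by ring, dvd_neg] at this
  · refine absurd ?_ hnot
    have := dvd_sub hR hS
    rwa [show S - -1 - (S - 1) = 2 by ring] at this
  · ring

variable {p : ℕ} [Fact p.Prime] {F : Type*} [Field F] [Algebra (ZMod p) F] [Finite F]

/-- The cardinality of the radical of the quadratic form `x ↦ Tr (a x ^ (p ^ k + 1))`. -/
def radCard (p : ℕ) [Fact p.Prime] {F : Type*} [Field F] [Algebra (ZMod p) F]
    (k : ℕ) (a : F) : ℕ :=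
  Nat.card (LinearMap.ker (powForm p k a + (powForm p k a).flip))

theorem two_ne_zero_zmod (hp : p ≠ 2) : (2 : ZMod p) ≠ 0 := by
  intro h
  have : ((2 : ℕ) : ZMod p) = 0 := by exact_mod_cast h
  rw [ZMod.natCast_eq_zero_iff] at this
  exact hp ((Nat.prime_dvd_prime_iff_eq Fact.out Nat.prime_two).1 this)

/-- The square of `N₀ - N₁` is known and `N₀ - N₁` is `1` modulo `p ^ d + 1`. Because `p ^ d` is
`-1` for this modulus, `p ^ (d * t)` is `(-1) ^ t`, so only one of the two square roots is possible.
-/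
theorem radCard_and_fiberCard_sub {d e t : ℕ} (hp : p ≠ 2) (hd : 0 < d)
    (hF : Nat.card F = p ^ (2 * d * t)) {a : F}
    (hr : radCard p (d * (2 * e + 1)) a = 1 ∨ radCard p (d * (2 * e + 1)) a = p ^ (2 * d)) :
    (radCard p (d * (2 * e + 1)) a = 1 ∧
      (fiberCard (powForm p (d * (2 * e + 1)) a) 0 : ℤ) -
        fiberCard (powForm p (d * (2 * e + 1)) a) 1 = (-1) ^ t * p ^ (d * t)) ∨
    (radCard p (d * (2 * e + 1)) a = p ^ (2 * d) ∧
      (fiberCard (powForm p (d * (2 * e + 1)) a) 0 : ℤ) -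
        fiberCard (powForm p (d * (2 * e + 1)) a) 1 = - ((-1) ^ t * p ^ (d * t) * p ^ d)) := by
  have hsq := fiberCard_sub_sq (two_ne_zero_zmod hp) (powForm p (d * (2 * e + 1)) a)
    (fun c hc => fiberCard_powForm_eq hF a c hc)
  have hmod := dvd_fiberCard_sub_sub_one (p := p) (e := e) hF a
  set S := (fiberCard (powForm p (d * (2 * e + 1)) a) 0 : ℤ) -
        fiberCard (powForm p (d * (2 * e + 1)) a) 1
  have hp1 : 1 < p := (Fact.out : p.Prime).one_lt
  have hD : (2 : ℤ) < p ^ d + 1 := by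
    have : 1 < p ^ d := Nat.one_lt_pow hd.ne' hp1
    have : (1 : ℤ) < (p : ℤ) ^ d := by exact_mod_cast this
    omega
  have hR (t : ℕ) : (p ^ d + 1 : ℤ) ∣ p ^ (d * t) - (-1) ^ t := by
    rw [pow_mul]
    have := sub_dvd_pow_sub_pow ((p : ℤ) ^ d) (-1) t
    rwa [sub_neg_eq_add] at this
  rw [hF] at hsq
  rcases hr with hr | hr
  · left
    refine ⟨hr, eq_sign_of_dvd hD (hR t) hmod ?_⟩
    rw [radCard] at hr
    rw [hsq, hr]
    push_cast
    ring
  · right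
    refine ⟨hr, ?_⟩
    -- The radical contributes an extra factor `p ^ d`, so the exponent of `-1` becomes `t + 1` and
    -- the sign is opposite to the nondegenerate case.
    have := eq_sign_of_dvd hD (hR (t + 1)) hmod (by
      rw [radCard] at hr
      rw [hsq, hr]
      push_cast
      ring)
    rw [this]
    ring

theorem radCard_eq {d e t : ℕ} (hg : Nat.gcd (2 * d * t) (2 * (d * (2 * e + 1))) = 2 * d)
    (hF : Nat.card F = p ^ (2 * d * t)) {a : F} (ha : a ≠ 0) :
    radCard p (d * (2 * e + 1)) a = 1 ∨ radCard p (d * (2 * e + 1)) a = p ^ (2 * d) := by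
  have := card_ker_powForm (p := p) (k := d * (2 * e + 1)) hF ha
  rwa [hg] at this

theorem one_ne_prime_pow {d : ℕ} (hd : 0 < d) : 1 ≠ p ^ (2 * d) :=
  (Nat.one_lt_pow (by omega) (Fact.out : p.Prime).one_lt).ne

/-- The number of degenerate forms `x ↦ Tr (a x ^ (p ^ k + 1))` with `a ≠ 0`. -/
theorem card_radCard_eq {d e t : ℕ} (hp : p ≠ 2) (hd : 0 < d)
    (hg : Nat.gcd (2 * d * t) (2 * (d * (2 * e + 1))) = 2 * d)
    (hF : Nat.card F = p ^ (2 * d * t)) :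
    Nat.card {a : F // a ≠ 0 ∧ radCard p (d * (2 * e + 1)) a = 1} =
      p ^ d * Nat.card {a : F // a ≠ 0 ∧ radCard p (d * (2 * e + 1)) a = p ^ (2 * d)} ∧
    Nat.card {a : F // a ≠ 0 ∧ radCard p (d * (2 * e + 1)) a = p ^ (2 * d)} * (p ^ d + 1) + 1 =
      p ^ (2 * d * t) := by
  classical
  have := Fintype.ofFinite F
  set k := d * (2 * e + 1) with hk
  have hp0 : (p : ℤ) ≠ 0 := by exact_mod_cast (Fact.out : p.Prime).ne_zero
  set n₁ := Nat.card {a : F // a ≠ 0 ∧ radCard p k a = 1} with hn₁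
  set n₂ := Nat.card {a : F // a ≠ 0 ∧ radCard p k a = p ^ (2 * d)} with hn₂
  set E := (Finset.univ.erase (0 : F)) with hE
  have h₁ : n₁ = (E.filter fun a => radCard p k a = 1).card := by
    rw [hn₁, Nat.card_eq_fintype_card, Fintype.card_subtype]
    congr 1; ext a; simp [hE]
  have hfil : (E.filter fun a => ¬ radCard p k a = 1) =
      Finset.univ.filter fun a => a ≠ 0 ∧ radCard p k a = p ^ (2 * d) := by
    ext a
    simp only [hE, Finset.mem_filter, Finset.mem_erase, Finset.mem_univ, and_true, true_and]
    constructor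
    · rintro ⟨ha, hr⟩
      exact ⟨ha, (radCard_eq hg hF ha).resolve_left hr⟩
    · rintro ⟨ha, hr⟩
      exact ⟨ha, fun h => one_ne_prime_pow hd (h.symm.trans hr)⟩
  have h₂ : n₂ = (E.filter fun a => ¬ radCard p k a = 1).card := by
    rw [hn₂, Nat.card_eq_fintype_card, Fintype.card_subtype, hfil]
  have hsum := sum_fiberCard_sub (p := p) (F := F) k
  rw [← Finset.sum_erase_add _ _ (Finset.mem_univ (0 : F)), (fiberCard_powForm_zero k).1,
    (fiberCard_powForm_zero k).2, ← hE, ← Finset.sum_filter_add_sum_filter_not E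
    (fun a => radCard p k a = 1)] at hsum
  have hs₁ : ∀ a ∈ E.filter (fun a => radCard p k a = 1),
      ((fiberCard (powForm p k a) 0 : ℤ) - fiberCard (powForm p k a) 1) =
        (-1) ^ t * p ^ (d * t) := by
    intro a ha
    simp only [hE, Finset.mem_filter, Finset.mem_erase, Finset.mem_univ, and_true] at ha
    rcases radCard_and_fiberCard_sub hp hd hF (radCard_eq hg hF ha.1) with h | h
    · exact h.2
    · exact absurd (ha.2.symm.trans h.1) (one_ne_prime_pow hd)
  have hs₂ : ∀ a ∈ E.filter (fun a => ¬ radCard p k a = 1),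
      ((fiberCard (powForm p k a) 0 : ℤ) - fiberCard (powForm p k a) 1) =
        - ((-1) ^ t * p ^ (d * t) * p ^ d) := by
    intro a ha
    simp only [hE, Finset.mem_filter, Finset.mem_erase, Finset.mem_univ, and_true] at ha
    rcases radCard_and_fiberCard_sub hp hd hF (radCard_eq hg hF ha.1) with h | h
    · exact absurd h.1 ha.2
    · exact h.2
  rw [Finset.sum_congr rfl hs₁, Finset.sum_congr rfl hs₂, Finset.sum_const, Finset.sum_const,
    ← h₁, ← h₂] at hsum
  have hcard : n₁ + n₂ + 1 = p ^ (2 * d * t) := by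
    rw [h₁, h₂, Finset.card_filter_add_card_filter_not, hE,
      Finset.card_erase_add_one (Finset.mem_univ _), Finset.card_univ, ← Nat.card_eq_fintype_card,
      hF]
  -- The term `a = 0` already equals the full sum `|F|`, so the contributions of the two classes
  -- with `a ≠ 0` cancel.
  have hn : n₁ = p ^ d * n₂ := by
    have hne : ((-1) ^ t * p ^ (d * t) : ℤ) ≠ 0 := by positivity
    have : ((n₁ : ℤ)) = p ^ d * n₂ := by
      apply mul_left_cancel₀ hne
      simp only [nsmul_eq_mul] at hsum
      push_cast at hsum
      linear_combination hsum
    exact_mod_cast this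
  refine ⟨hn, ?_⟩
  rw [← hcard, hn]
  ring

end PowFormClassification

/-! ### Zeros of `Tr (a x ^ (p ^ k + 1) + b x)` for fixed `a` -/

section PairCount

variable {p : ℕ} [Fact p.Prime] {F : Type*} [Field F] [Algebra (ZMod p) F] [Finite F]

/-- The number of zeros of `x ↦ Tr (a x ^ (p ^ k + 1) + b x)`. -/
def pairZeros (p : ℕ) [Fact p.Prime] {F : Type*} [Field F] [Algebra (ZMod p) F]
    (k : ℕ) (a b : F) : ℕ :=
  Nat.card {x : F // Algebra.trace (ZMod p) F (a * x ^ (p ^ k + 1) + b * x) = 0}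

theorem pairZeros_eq_zeroCard (k : ℕ) (a b : F) :
    pairZeros p k a b = zeroCard (powForm p k a) (Algebra.traceForm (ZMod p) F b) := by
  simp only [pairZeros, zeroCard, powForm_self, Algebra.traceForm_apply, map_add]

theorem traceForm_bijective : Function.Bijective (Algebra.traceForm (ZMod p) F) := by
  have hinj : Function.Injective (Algebra.traceForm (ZMod p) F) := by
    rw [injective_iff_map_eq_zero]
    intro b hb
    apply eq_zero_of_trace_mul_eq_zero (p := p)
    intro x
    exact LinearMap.congr_fun hb x
  refine ⟨hinj, ?_⟩
  exact (LinearMap.injective_iff_surjective_of_finrank_eq_finrank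
    (Subspace.dual_finrank_eq (K := ZMod p) (V := F)).symm).1 hinj

theorem card_pairZeros_eq_card_zeroCard (k : ℕ) (a : F) (v : ℕ) :
    Nat.card {b : F // pairZeros p k a b = v} =
      Nat.card {f : F →ₗ[ZMod p] ZMod p // zeroCard (powForm p k a) f = v} := by
  refine Nat.card_congr ((Equiv.ofBijective _ (traceForm_bijective (p := p) (F := F))).subtypeEquiv
    fun b => ?_)
  rw [pairZeros_eq_zeroCard]
  rfl

/-- Distribution of `pairZeros p k a b` over `b`, in terms of `s = (N₀ - N₁) / p`. -/
theorem pairZeros_distribution (hp : p ≠ 2) {k : ℕ} {a : F} {q s : ℤ} (hs : s ≠ 0)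
    (hG : ∀ c, c ≠ 0 → fiberCard (powForm p k a) c = fiberCard (powForm p k a) 1)
    (hq : p * q = Nat.card F)
    (hS : (fiberCard (powForm p k a) 0 : ℤ) - fiberCard (powForm p k a) 1 = p * s) :
    (radCard p k a * Nat.card {b : F // (pairZeros p k a b : ℤ) = q + s * (p - 1)} : ℤ) =
      q + s * (p - 1) ∧
    (radCard p k a * Nat.card {b : F // (pairZeros p k a b : ℤ) = q + s * (-1)} : ℤ) =
      (p - 1) * (q - s) ∧
    (radCard p k a * Nat.card {b : F // (pairZeros p k a b : ℤ) = q} : ℤ) =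
      p * q * (radCard p k a - 1) ∧
    ∀ b, (pairZeros p k a b : ℤ) = q + s * (p - 1) ∨ (pairZeros p k a b : ℤ) = q + s * (-1) ∨
      (pairZeros p k a b : ℤ) = q := by
  have hp0 : (0 : ℤ) < p := by exact_mod_cast (Fact.out : p.Prime).pos
  have hp1 : (1 : ℤ) < p := by exact_mod_cast (Fact.out : p.Prime).one_lt
  have hadd := fiberCard_zero_add (powForm p k a) hG
  rw [Nat.card_zmod, ← hq] at hadd
  -- The values `N₀ = q + s (p - 1)` and `N₁ = q - s` solve `N₀ + (p - 1) N₁ = p q` and `N₀ - N₁ = p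
  -- s`.
  have h0 : (fiberCard (powForm p k a) 0 : ℤ) = q + s * (p - 1) := by
    apply mul_left_cancel₀ hp0.ne'
    linear_combination hadd + (p - 1) * hS
  have h1 : (fiberCard (powForm p k a) 1 : ℤ) = q + s * (-1) := by linarith
  have hq0 : 0 ≤ q := by
    have : (0 : ℤ) ≤ p * q := by rw [hq]; positivity
    exact nonneg_of_mul_nonneg_right this hp0
  lift q to ℕ using hq0
  have hsp : s * (p - 1) ≠ 0 := mul_ne_zero hs (by omega)
  obtain ⟨htri, hA, hB, hC⟩ := zeroCard_distribution (two_ne_zero_zmod hp) (powForm p k a) hG q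
    (by rw [Nat.card_zmod]; exact_mod_cast hq)
    (by intro h
        rw [h, sub_self] at hS
        exact mul_ne_zero hp0.ne' hs hS.symm)
    (by zify; rw [h0]; omega) (by zify; rw [h1]; omega)
  rw [← card_pairZeros_eq_card_zeroCard] at hA hB
  simp only [← card_pairZeros_eq_card_zeroCard] at hC
  rw [← h0, ← h1]
  simp only [Nat.cast_inj]
  rw [← radCard] at hA hB
  zify at hA hB hC
  simp only [Nat.cast_inj] at hA hB hC
  rw [← hq] at hB hC
  refine ⟨hA, ?_, ?_, ?_⟩
  · rw [h0] at hB
    linear_combination hB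
  · linear_combination radCard p k a * hC - hB - hA
  · intro b
    rw [pairZeros_eq_zeroCard]
    exact htri _

theorem card_pairs_eq {k d : ℕ} (v : ℤ) {A B : ℚ} (hd : 0 < d)
    (hr : ∀ a : F, a ≠ 0 → radCard p k a = 1 ∨ radCard p k a = p ^ (2 * d))
    (hA : ∀ a : F, a ≠ 0 → radCard p k a = 1 →
      (Nat.card {b : F // (pairZeros p k a b : ℤ) = v} : ℚ) = A)
    (hB : ∀ a : F, a ≠ 0 → radCard p k a = p ^ (2 * d) →
      (Nat.card {b : F // (pairZeros p k a b : ℤ) = v} : ℚ) = B) :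
    (Nat.card {ab : F × F // (pairZeros p k ab.1 ab.2 : ℤ) = v} : ℚ) =
      Nat.card {b : F // (pairZeros p k 0 b : ℤ) = v} +
      Nat.card {a : F // a ≠ 0 ∧ radCard p k a = 1} * A +
      Nat.card {a : F // a ≠ 0 ∧ radCard p k a = p ^ (2 * d)} * B := by
  classical
  have := Fintype.ofFinite F
  have e : {ab : F × F // (pairZeros p k ab.1 ab.2 : ℤ) = v} ≃
      Σ a : F, {b : F // (pairZeros p k a b : ℤ) = v} :=
    { toFun := fun ab => ⟨ab.1.1, ab.1.2, ab.2⟩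
      invFun := fun s => ⟨(s.1, s.2.1), s.2.2⟩
      left_inv := fun _ => rfl
      right_inv := fun _ => rfl }
  rw [Nat.card_congr e, Nat.card_sigma, Nat.cast_sum,
    ← Finset.sum_erase_add _ _ (Finset.mem_univ (0 : F)),
    ← Finset.sum_filter_add_sum_filter_not (Finset.univ.erase (0 : F))
      (fun a => radCard p k a = 1)]
  have hfil₁ : ((Finset.univ.erase (0 : F)).filter fun a => radCard p k a = 1) =
      Finset.univ.filter fun a => a ≠ 0 ∧ radCard p k a = 1 := by
    ext a
    simp
  have hfil₂ : ((Finset.univ.erase (0 : F)).filter fun a => ¬ radCard p k a = 1) =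
      Finset.univ.filter fun a => a ≠ 0 ∧ radCard p k a = p ^ (2 * d) := by
    ext a
    simp only [Finset.mem_filter, Finset.mem_erase, Finset.mem_univ, and_true, true_and]
    constructor
    · rintro ⟨ha, h⟩
      exact ⟨ha, (hr a ha).resolve_left h⟩
    · rintro ⟨ha, h⟩
      exact ⟨ha, fun h' => one_ne_prime_pow hd (h'.symm.trans h)⟩
  rw [hfil₁, hfil₂, Finset.sum_congr rfl (fun a ha => hA a (Finset.mem_filter.1 ha).2.1
      (Finset.mem_filter.1 ha).2.2), Finset.sum_congr rfl (fun a ha => hB a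
      (Finset.mem_filter.1 ha).2.1 (Finset.mem_filter.1 ha).2.2), Finset.sum_const,
    Finset.sum_const, ← Fintype.card_subtype, ← Fintype.card_subtype,
    ← Nat.card_eq_fintype_card, ← Nat.card_eq_fintype_card, nsmul_eq_mul, nsmul_eq_mul]
  ring

theorem pairZeros_zero_zero {p : ℕ} [Fact p.Prime] {F : Type*} [Field F] [Algebra (ZMod p) F]
    (k : ℕ) : pairZeros p k (0 : F) 0 = Nat.card F := by
  simp [pairZeros]

theorem pairZeros_zero_left {q : ℤ} (hq : p * q = Nat.card F) (k : ℕ) {b : F} (hb : b ≠ 0) :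
    (pairZeros p k (0 : F) b : ℤ) = q := by
  have := card_mul_card_linear_fiber _ (trace_comp_mulRight_ne_zero (p := p) hb) 0
  rw [Nat.card_zmod] at this
  have hp0 : (p : ℤ) ≠ 0 := by exact_mod_cast (Fact.out : p.Prime).ne_zero
  apply mul_left_cancel₀ hp0
  rw [hq, ← this, pairZeros]
  simp [mul_comm]

theorem card_pairZeros_zero {q : ℤ} (hq : p * q = Nat.card F) (k : ℕ) :
    Nat.card {b : F // (pairZeros p k 0 b : ℤ) = p * q} = 1 ∧
    (Nat.card {b : F // (pairZeros p k 0 b : ℤ) = q} : ℤ) = p * q - 1 ∧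
    ∀ v : ℤ, v ≠ q → v ≠ p * q → Nat.card {b : F // (pairZeros p k 0 b : ℤ) = v} = 0 := by
  have hp1 : (1 : ℤ) < p := by exact_mod_cast (Fact.out : p.Prime).one_lt
  have hpos : (0 : ℤ) < p * q := by rw [hq]; exact_mod_cast Nat.card_pos
  have hq0 : 0 < q := pos_of_mul_pos_right hpos (by omega)
  have hne : p * q ≠ q := by nlinarith
  have hiff1 (b : F) : (pairZeros p k 0 b : ℤ) = p * q ↔ b = 0 := by
    constructor
    · intro h
      by_contra hb
      rw [pairZeros_zero_left hq k hb] at h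
      exact hne h.symm
    · rintro rfl
      rw [pairZeros_zero_zero, hq]
  have hiff2 (b : F) : (pairZeros p k 0 b : ℤ) = q ↔ b ≠ 0 := by
    constructor
    · rintro h rfl
      rw [pairZeros_zero_zero, ← hq] at h
      exact hne h
    · exact pairZeros_zero_left hq k
  refine ⟨?_, ?_, ?_⟩
  · simp_rw [hiff1]
    simp
  · simp_rw [hiff2]
    have := Fintype.ofFinite F
    classical
    rw [hq, ← Nat.card_congr unitsEquivNeZero, Nat.card_units, Nat.cast_sub Nat.card_pos]
    simp
  · intro v h1 h2
    rw [Nat.card_eq_zero]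
    left
    refine ⟨fun ⟨b, hb⟩ => ?_⟩
    by_cases h : b = 0
    · exact h2 (hb.symm.trans ((hiff1 b).2 h))
    · exact h1 (hb.symm.trans ((hiff2 b).2 h))

end PairCount

/-! ### Distribution over all pairs `(a, b)` -/

section PairDistribution

variable {p : ℕ} [Fact p.Prime] {F : Type*} [Field F] [Algebra (ZMod p) F] [Finite F]

theorem pairZeros_distribution_of_radCard_eq_one (hp : p ≠ 2) {k : ℕ} {a : F} {q s : ℤ}
    (hs : s ≠ 0)
    (hG : ∀ c, c ≠ 0 → fiberCard (powForm p k a) c = fiberCard (powForm p k a) 1)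
    (hq : p * q = Nat.card F)
    (hS : (fiberCard (powForm p k a) 0 : ℤ) - fiberCard (powForm p k a) 1 = p * s)
    (hr : radCard p k a = 1) :
    (Nat.card {b : F // (pairZeros p k a b : ℤ) = q + s * (p - 1)} : ℚ) = q + s * (p - 1) ∧
    (Nat.card {b : F // (pairZeros p k a b : ℤ) = q + s * (-1)} : ℚ) = (p - 1) * (q - s) ∧
    ∀ v : ℤ, v ≠ q + s * (p - 1) → v ≠ q + s * (-1) →
      (Nat.card {b : F // (pairZeros p k a b : ℤ) = v} : ℚ) = 0 := by
  obtain ⟨h1, h2, h3, h4⟩ := pairZeros_distribution hp hs hG hq hS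
  rw [hr] at h1 h2 h3
  simp only [Nat.cast_one, one_mul, sub_self, mul_zero] at h1 h2 h3
  refine ⟨by exact_mod_cast congrArg (Int.cast : ℤ → ℚ) h1,
    by exact_mod_cast congrArg (Int.cast : ℤ → ℚ) h2, fun v hv1 hv2 => ?_⟩
  by_cases hvq : v = q
  · rw [hvq]; exact_mod_cast h3
  · rw [Nat.cast_eq_zero, Nat.card_eq_zero]
    left
    refine ⟨fun ⟨b, hb⟩ => ?_⟩
    have := h4 b
    rw [hb] at this
    tauto

theorem pairZeros_distribution_of_radCard_eq_sq (hp : p ≠ 2) {k : ℕ} {a : F} {q s : ℤ} {D : ℕ}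
    (hD : D ≠ 0) (hs : s ≠ 0)
    (hG : ∀ c, c ≠ 0 → fiberCard (powForm p k a) c = fiberCard (powForm p k a) 1)
    (hq : p * q = Nat.card F)
    (hS : (fiberCard (powForm p k a) 0 : ℤ) - fiberCard (powForm p k a) 1 = p * s)
    (hr : radCard p k a = D ^ 2) :
    (Nat.card {b : F // (pairZeros p k a b : ℤ) = q + s * (p - 1)} : ℚ) =
      (q + s * (p - 1)) / D ^ 2 ∧
    (Nat.card {b : F // (pairZeros p k a b : ℤ) = q + s * (-1)} : ℚ) =
      (p - 1) * (q - s) / D ^ 2 ∧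
    (Nat.card {b : F // (pairZeros p k a b : ℤ) = q} : ℚ) = p * q * (D ^ 2 - 1) / D ^ 2 ∧
    ∀ v : ℤ, v ≠ q + s * (p - 1) → v ≠ q + s * (-1) → v ≠ q →
      (Nat.card {b : F // (pairZeros p k a b : ℤ) = v} : ℚ) = 0 := by
  obtain ⟨h1, h2, h3, h4⟩ := pairZeros_distribution hp hs hG hq hS
  rw [hr] at h1 h2 h3
  have hD' : (D ^ 2 : ℚ) ≠ 0 := by positivity
  refine ⟨?_, ?_, ?_, fun v hv1 hv2 hvq => ?_⟩
  · rw [eq_div_iff hD', mul_comm]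
    exact_mod_cast congrArg (Int.cast : ℤ → ℚ) h1
  · rw [eq_div_iff hD', mul_comm]
    exact_mod_cast congrArg (Int.cast : ℤ → ℚ) h2
  · rw [eq_div_iff hD', mul_comm]
    exact_mod_cast congrArg (Int.cast : ℤ → ℚ) h3
  · rw [Nat.cast_eq_zero, Nat.card_eq_zero]
    left
    refine ⟨fun ⟨b, hb⟩ => ?_⟩
    have := h4 b
    rw [hb] at this
    tauto

/-- The number of pairs `(a, b)` for which `x ↦ Tr (a x ^ (p ^ k + 1) + b x)` has `v` zeros. -/
def pairCount (p : ℕ) [Fact p.Prime] (F : Type*) [Field F] [Algebra (ZMod p) F]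
    (k : ℕ) (v : ℤ) : ℕ :=
  Nat.card {ab : F × F // (pairZeros p k ab.1 ab.2 : ℤ) = v}

set_option maxHeartbeats 800000 in
-- Each possible number of zeros is written as `q + s u`, so that keeping the values apart reduces
-- to comparing the coefficients `u`. The bound `2 ≤ t` matters here: for `t = 1` the value `q - s D
-- (p - 1)` would coincide with `p q`.
theorem pairCount_eq {d e t : ℕ} (hp : p ≠ 2) (hd : 0 < d) (ht : 2 ≤ t)
    (hg : Nat.gcd (2 * d * t) (2 * (d * (2 * e + 1))) = 2 * d)
    (hF : Nat.card F = p ^ (2 * d * t)) {q s D : ℤ} (hqd : q = p ^ (2 * d * t - 1))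
    (hsd : s = (-1) ^ t * p ^ (d * t - 1)) (hDd : D = p ^ d) :
    (pairCount p F (d * (2 * e + 1)) (p * q) : ℚ) = 1 ∧
    (pairCount p F (d * (2 * e + 1)) q : ℚ) =
      p * q - 1 + (p * q - 1) / (D + 1) * (p * q * (D ^ 2 - 1) / D ^ 2) ∧
    (pairCount p F (d * (2 * e + 1)) (q + s * (p - 1)) : ℚ) =
      D * (p * q - 1) / (D + 1) * (q + s * (p - 1)) ∧
    (pairCount p F (d * (2 * e + 1)) (q + s * (-1)) : ℚ) =
      D * (p * q - 1) / (D + 1) * ((p - 1) * (q - s)) ∧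
    (pairCount p F (d * (2 * e + 1)) (q + -(s * D) * (p - 1)) : ℚ) =
      (p * q - 1) / (D + 1) * ((q + -(s * D) * (p - 1)) / D ^ 2) ∧
    (pairCount p F (d * (2 * e + 1)) (q + -(s * D) * (-1)) : ℚ) =
      (p * q - 1) / (D + 1) * ((p - 1) * (q - -(s * D)) / D ^ 2) ∧
    ∀ v : ℤ, v ≠ p * q → v ≠ q → v ≠ q + s * (p - 1) → v ≠ q + s * (-1) →
      v ≠ q + -(s * D) * (p - 1) → v ≠ q + -(s * D) * (-1) →
      pairCount p F (d * (2 * e + 1)) v = 0 := by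
  set k := d * (2 * e + 1) with hk
  have hp3 : (3 : ℤ) ≤ p := by
    have := (Fact.out : p.Prime).two_le
    omega
  have hp0 : (0 : ℤ) < p := by omega
  have hdt : 2 * d ≤ d * t := by nlinarith
  have hpD : (p : ℤ) ≤ D := by
    rw [hDd]
    exact_mod_cast Nat.le_self_pow hd.ne' p
  have hσ : ∃ σ : ℤ, σ = p ^ (d * t - 1) ∧ q = p * σ ^ 2 ∧ D ≤ σ ∧ p * σ = p ^ (d * t) := by
    refine ⟨_, rfl, ?_, ?_, ?_⟩
    · rw [hqd, ← pow_mul, ← pow_succ']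
      congr 1
      have : 2 * d * t = 2 * (d * t) := by ring
      omega
    · rw [hDd]
      exact pow_le_pow_right₀ (by omega) (by omega)
    · rw [← pow_succ']
      congr 1
      omega
  obtain ⟨σ, hσd, hqσ, hDσ, hpσ⟩ := hσ
  rw [← hσd] at hsd
  have hDp : D < D * (p - 1) := by nlinarith
  have hDp0 : 0 ≤ D * (p - 1) := by omega
  have hlt : D * (p - 1) < p * σ * (p - 1) :=
    mul_lt_mul_of_pos_right (by nlinarith) (by omega)
  have hσ0 : 0 < σ := by omega
  have hs0 : s ≠ 0 := by rw [hsd]; positivity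
  have hpq : p * q = Nat.card F := by
    rw [hF, hqd, ← pow_succ', Nat.sub_add_cancel (by nlinarith)]
    push_cast
    rfl
  have hsD0 : -(s * D) ≠ 0 := neg_ne_zero.2 (mul_ne_zero hs0 (by omega))
  have hr (a : F) (ha : a ≠ 0) := radCard_eq (p := p) hg hF ha
  have hG (a : F) : ∀ c, c ≠ 0 → fiberCard (powForm p k a) c = fiberCard (powForm p k a) 1 :=
    fun c hc => fiberCard_powForm_eq hF a c hc
  have hS₁ (a : F) (ha : a ≠ 0) (h : radCard p k a = 1) :
      (fiberCard (powForm p k a) 0 : ℤ) - fiberCard (powForm p k a) 1 = p * s := by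
    rcases radCard_and_fiberCard_sub hp hd hF (hr a ha) with h' | h'
    · rw [h'.2, hsd, ← hpσ]; ring
    · exact absurd (h.symm.trans h'.1) (one_ne_prime_pow hd)
  have hS₂ (a : F) (ha : a ≠ 0) (h : radCard p k a = p ^ (2 * d)) :
      (fiberCard (powForm p k a) 0 : ℤ) - fiberCard (powForm p k a) 1 = p * -(s * D) := by
    rcases radCard_and_fiberCard_sub hp hd hF (hr a ha) with h' | h'
    · exact absurd (h'.1.symm.trans h) (one_ne_prime_pow hd)
    · rw [h'.2, hsd, hDd, ← hpσ]; ring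
  have hT₁ (a : F) (ha : a ≠ 0) (h : radCard p k a = 1) :=
    pairZeros_distribution_of_radCard_eq_one hp hs0 (hG a) hpq (hS₁ a ha h) h
  have hT₂ (a : F) (ha : a ≠ 0) (h : radCard p k a = p ^ (2 * d)) :=
    pairZeros_distribution_of_radCard_eq_sq hp (D := p ^ d)
      (pow_pos (Fact.out : p.Prime).pos d).ne' hsD0 (hG a) hpq (hS₂ a ha h)
      (by rw [h, ← pow_mul, mul_comm])
  have hDQ : (((p ^ d : ℕ) : ℚ)) = D := by rw [hDd]; push_cast; rfl
  rw [hDQ] at hT₂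
  obtain ⟨hZ₁, hZ₂, hZ₃⟩ := card_pairZeros_zero hpq k
  have hZ₂' : (Nat.card {b : F // (pairZeros p k 0 b : ℤ) = q} : ℚ) = p * q - 1 := by
    exact_mod_cast congrArg (Int.cast : ℤ → ℚ) hZ₂
  obtain ⟨hn₁, hn₂⟩ := card_radCard_eq hp hd hg hF
  rw [← hF] at hn₂
  rw [← hk] at hn₁ hn₂
  have hD1 : (D + 1 : ℚ) ≠ 0 := by
    have : D + 1 ≠ 0 := by omega
    exact_mod_cast this
  have hn₂' : (Nat.card {a : F // a ≠ 0 ∧ radCard p k a = p ^ (2 * d)} : ℚ) =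
      (p * q - 1) / (D + 1) := by
    rw [eq_div_iff hD1]
    have h1 := congrArg (Nat.cast : ℕ → ℚ) hn₂
    have h2 := congrArg (Int.cast : ℤ → ℚ) hpq
    rw [Nat.cast_add, Nat.cast_mul, Nat.cast_add, hDQ] at h1
    push_cast at h1 h2
    linarith
  have hn₁' : (Nat.card {a : F // a ≠ 0 ∧ radCard p k a = 1} : ℚ) =
      D * (p * q - 1) / (D + 1) := by
    rw [hn₁, Nat.cast_mul, hDQ, hn₂', mul_div_assoc]
  have hcount (v : ℤ) {A B : ℚ} := card_pairs_eq (A := A) (B := B) (p := p) (k := k) v hd hr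
  rw [hn₁', hn₂'] at hcount
  have hsub {u v : ℤ} (huv : u ≠ v) : q + s * u ≠ q + s * v := by
    intro h
    exact huv (mul_left_cancel₀ hs0 (add_left_cancel h))
  have hz : q = q + s * 0 := by ring
  have ha : q + -(s * D) * (p - 1) = q + s * (-(D * (p - 1))) := by ring
  have hb : q + -(s * D) * (-1) = q + s * D := by ring
  -- The coefficient of the value `p q`, attained by the zero pair, exceeds every other coefficient
  -- in absolute value; this uses `D ≤ σ`.
  have hw : ∃ w : ℤ, p * q = q + s * w ∧ D * (p - 1) < |w| := by
    rcases neg_one_pow_eq_or ℤ t with h | h <;> rw [h] at hsd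
    · refine ⟨p * σ * (p - 1), ?_, ?_⟩
      · rw [hsd, hqσ]; ring
      · rwa [abs_of_nonneg (hDp0.trans hlt.le)]
    · refine ⟨-(p * σ * (p - 1)), ?_, ?_⟩
      · rw [hsd, hqσ]; ring
      · rwa [abs_neg, abs_of_nonneg (hDp0.trans hlt.le)]
  obtain ⟨w, hpw, hw⟩ := hw
  have w0 : w ≠ 0 := by rintro rfl; simp at hw; omega
  have w1 : w ≠ p - 1 := by rintro rfl; rw [abs_of_nonneg (by omega)] at hw; omega
  have w2 : w ≠ -1 := by rintro rfl; simp at hw; omega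
  have w3 : w ≠ -(D * (p - 1)) := by
    rintro rfl; rw [abs_neg, abs_of_nonneg (by omega)] at hw; omega
  have w4 : w ≠ D := by rintro rfl; rw [abs_of_nonneg (by omega)] at hw; omega
  simp only [pairCount]
  simp only [ha, hb] at hT₂ ⊢
  refine ⟨?_, ?_, ?_, ?_, ?_, ?_, ?_⟩
  · rw [hcount (p * q) (A := 0) (B := 0), hZ₁]
    · simp
    · intro a ha hra
      refine (hT₁ a ha hra).2.2 _ ?_ ?_ <;> rw [hpw] <;> exact hsub (by assumption)
    · intro a ha hra
      refine (hT₂ a ha hra).2.2.2 _ ?_ ?_ ?_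
      · rw [hpw]; exact hsub w3
      · rw [hpw]; exact hsub w4
      · rw [hpw]; nth_rw 2 [hz]; exact hsub w0
  · rw [hcount q (A := 0), hZ₂']
    · rw [mul_zero, add_zero]
    · intro a ha hra
      refine (hT₁ a ha hra).2.2 _ ?_ ?_ <;> nth_rw 1 [hz] <;> exact hsub (by omega)
    · intro a ha hra
      exact (hT₂ a ha hra).2.2.1
  · rw [hcount _ (B := 0) (fun a ha hra => (hT₁ a ha hra).1), hZ₃]
    · simp
    · nth_rw 2 [hz]; exact hsub (by omega)
    · rw [hpw]; exact hsub w1.symm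
    · intro a ha hra
      refine (hT₂ a ha hra).2.2.2 _ (hsub (by omega)) (hsub (by omega)) ?_
      nth_rw 2 [hz]; exact hsub (by omega)
  · rw [hcount _ (B := 0) (fun a ha hra => (hT₁ a ha hra).2.1), hZ₃]
    · simp
    · nth_rw 2 [hz]; exact hsub (by omega)
    · rw [hpw]; exact hsub w2.symm
    · intro a ha hra
      refine (hT₂ a ha hra).2.2.2 _ (hsub (by omega)) (hsub (by omega)) ?_
      nth_rw 2 [hz]; exact hsub (by omega)
  · rw [hcount _ (A := 0) ?_ (fun a ha hra => (hT₂ a ha hra).1), hZ₃]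
    · push_cast; ring
    · nth_rw 2 [hz]; exact hsub (by omega)
    · rw [hpw]; exact hsub w3.symm
    · intro a ha hra
      exact (hT₁ a ha hra).2.2 _ (hsub (by omega)) (hsub (by omega))
  · rw [hcount _ (A := 0) ?_ (fun a ha hra => (hT₂ a ha hra).2.1), hZ₃]
    · push_cast; ring
    · nth_rw 2 [hz]; exact hsub (by omega)
    · rw [hpw]; exact hsub w4.symm
    · intro a ha hra
      exact (hT₁ a ha hra).2.2 _ (hsub (by omega)) (hsub (by omega))
  · intro v v1 v2 v3 v4 v5 v6
    have := hcount v (A := 0) (B := 0) (fun a ha hra => (hT₁ a ha hra).2.2 _ v3 v4)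
      (fun a ha hra => (hT₂ a ha hra).2.2.2 _ v5 v6 v2)
    rw [hZ₃ v v2 v1] at this
    simpa using this

end PairDistribution

/-! ### Cyclic codes and parity-check polynomials -/

section CyclicCode

theorem pow_finRotate {M : Type*} [Monoid M] {n : ℕ} {y : M} (hy : y ^ n = 1) (j : Fin n) :
    y ^ (finRotate n j : ℕ) = y ^ ((j : ℕ) + 1) := by
  obtain _ | n := n
  · exact j.elim0
  · rw [finRotate_apply, Fin.val_add_one]
    split_ifs with h
    · rw [h, Fin.val_last, hy, pow_zero]
    · rfl

variable {K : Type*} [Field K] {n : ℕ}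

theorem mk_X_pow_eq_one :
    (Ideal.Quotient.mk (Ideal.span {(X ^ n - 1 : K[X])}) X) ^ n = 1 := by
  rw [← map_pow, ← sub_eq_zero, ← map_one (Ideal.Quotient.mk _), ← map_sub,
    Ideal.Quotient.eq_zero_iff_mem]
  exact Ideal.mem_span_singleton_self _

theorem wordClass_apply (c : Fin n → K) :
    wordClass n c = Ideal.Quotient.mk (Ideal.span {(X ^ n - 1 : K[X])}) (wordPoly n c) := rfl

theorem wordClass_cyclicShift (c : Fin n → K) :
    wordClass n (cyclicShift c) =
      Ideal.Quotient.mk (Ideal.span {(X ^ n - 1 : K[X])}) X * wordClass n c := by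
  rw [wordClass_apply, wordClass_apply, ← map_mul]
  simp only [wordPoly, LinearMap.coe_mk, AddHom.coe_mk, cyclicShift]
  rw [← Equiv.sum_comp (finRotate n)]
  simp only [Equiv.symm_apply_apply, Finset.mul_sum, map_sum, map_mul, map_pow]
  refine Finset.sum_congr rfl fun j _ => ?_
  rw [pow_finRotate mk_X_pow_eq_one, pow_succ]
  ring

theorem isCyclicCode_codeOfGenerator (g : K[X]) : IsCyclicCode (codeOfGenerator n g) := by
  intro c hc
  change wordClass n (cyclicShift c) ∈ Ideal.span _
  rw [wordClass_cyclicShift]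
  exact Ideal.mul_mem_left _ _ hc

theorem mem_codeOfGenerator_iff {g : K[X]} (hg : g ∣ X ^ n - 1) (c : Fin n → K) :
    c ∈ codeOfGenerator n g ↔ g ∣ wordPoly n c := by
  change wordClass n c ∈ Ideal.span _ ↔ _
  rw [wordClass_apply, Ideal.mem_span_singleton]
  constructor
  · rintro ⟨r, hr⟩
    obtain ⟨r, rfl⟩ := Ideal.Quotient.mk_surjective r
    rw [← map_mul, Ideal.Quotient.eq, Ideal.mem_span_singleton] at hr
    exact (dvd_iff_dvd_of_dvd_sub (hg.trans hr)).2 (dvd_mul_right _ _)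
  · exact fun h => map_dvd _ h

/-- With `g = (X ^ n - 1) / h`, divisibility of a word by `g` is divisibility of its product with
`h` by `h g = X ^ n - 1`. -/
theorem mem_codeOfParityCheck_iff (hn : 0 < n) {h : K[X]} (hh : h ∣ X ^ n - 1) (c : Fin n → K) :
    c ∈ codeOfParityCheck n h ↔
      Ideal.Quotient.mk (Ideal.span {(X ^ n - 1 : K[X])}) h * wordClass n c = 0 := by
  have hX : (X ^ n - 1 : K[X]) ≠ 0 := X_pow_sub_C_ne_zero hn 1
  have hh0 : h ≠ 0 := fun h0 => hX (zero_dvd_iff.1 (h0 ▸ hh))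
  have hmul : h * ((X ^ n - 1) / h) = X ^ n - 1 := EuclideanDomain.mul_div_cancel' hh0 hh
  rw [codeOfParityCheck, mem_codeOfGenerator_iff ⟨h, by rw [mul_comm, hmul]⟩, wordClass_apply,
    ← map_mul, Ideal.Quotient.eq_zero_iff_mem, Ideal.mem_span_singleton]
  nth_rw 2 [← hmul]
  rw [mul_dvd_mul_iff_left hh0]

theorem coeff_wordPoly (c : Fin n → K) (i : Fin n) : (wordPoly n c).coeff i = c i := by
  simp [wordPoly, coeff_C_mul, coeff_X_pow, Fin.val_inj]

/-- A codeword is `g r` with `deg r < deg h`. The upper bound suffices, since the trace words supply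
the lower one. -/
theorem finrank_codeOfParityCheck_le (hn : 0 < n) {h : K[X]} (hh : h ∣ X ^ n - 1) :
    Module.finrank K (codeOfParityCheck n h) ≤ h.natDegree := by
  have hX : (X ^ n - 1 : K[X]) ≠ 0 := X_pow_sub_C_ne_zero hn 1
  have hh0 : h ≠ 0 := fun h0 => hX (zero_dvd_iff.1 (h0 ▸ hh))
  set g := (X ^ n - 1) / h with hg
  have hmul : h * g = X ^ n - 1 := EuclideanDomain.mul_div_cancel' hh0 hh
  have hg0 : g ≠ 0 := by rintro h0; rw [h0, mul_zero] at hmul; exact hX hmul.symm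
  have hdeg : h.natDegree + g.natDegree = n := by
    rw [← natDegree_mul hh0 hg0, hmul]
    exact natDegree_X_pow_sub_C (r := (1 : K))
  let L : degreeLT K h.natDegree →ₗ[K] (Fin n → K) :=
    (LinearMap.pi fun i : Fin n => lcoeff K i) ∘ₗ (LinearMap.mulLeft K g) ∘ₗ
      (degreeLT K h.natDegree).subtype
  have hle : codeOfParityCheck n h ≤ LinearMap.range L := by
    intro c hc
    rw [codeOfParityCheck, mem_codeOfGenerator_iff ⟨h, by rw [mul_comm, hmul]⟩] at hc
    obtain ⟨r, hr⟩ := hc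
    refine ⟨⟨r, ?_⟩, ?_⟩
    · rw [mem_degreeLT]
      by_cases hr0 : r = 0
      · rw [hr0, degree_zero]; exact WithBot.bot_lt_coe _
      · have hlt : (g * r).degree < n := hr ▸ degree_sum_fin_lt c
        rw [ degree_eq_natDegree (mul_ne_zero hg0 hr0), natDegree_mul hg0 hr0] at hlt
        rw [degree_eq_natDegree hr0]
        have : g.natDegree + r.natDegree < n := by exact_mod_cast hlt
        have : r.natDegree < h.natDegree := by omega
        exact_mod_cast this
    · ext i
      exact (congrArg (fun f => f.coeff (i : ℕ)) hr).symm.trans (coeff_wordPoly c i)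
  have : Module.Finite K (degreeLT K h.natDegree) :=
    Module.Finite.equiv (degreeLTEquiv K h.natDegree).symm
  calc Module.finrank K (codeOfParityCheck n h) ≤ Module.finrank K (LinearMap.range L) :=
        Submodule.finrank_mono hle
    _ ≤ Module.finrank K (degreeLT K h.natDegree) := LinearMap.finrank_range_le L
    _ = h.natDegree := by
        rw [(degreeLTEquiv K h.natDegree).finrank_eq, Module.finrank_fin_fun]

end CyclicCode

/-! ### Trace words as codewords -/

section TraceCode

variable {p : ℕ} [Fact p.Prime] {F : Type*} [Field F] [Algebra (ZMod p) F]

/-- The word `(Tr (a α ^ (i (p ^ k + 1)) + b α ^ i))ᵢ`. -/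
def traceWord (p : ℕ) [Fact p.Prime] {F : Type*} [Field F] [Algebra (ZMod p) F]
    (n k : ℕ) (α : F) :
    F × F →ₗ[ZMod p] (Fin n → ZMod p) :=
  LinearMap.pi fun i => (Algebra.trace (ZMod p) F) ∘ₗ
    ((LinearMap.mulRight (ZMod p) ((α ^ (i : ℕ)) ^ (p ^ k + 1))).coprod
      (LinearMap.mulRight (ZMod p) (α ^ (i : ℕ))))

theorem traceWord_apply (n k : ℕ) (α : F) (a b : F) (i : Fin n) :
    traceWord p n k α (a, b) i =
      Algebra.trace (ZMod p) F (a * (α ^ (i : ℕ)) ^ (p ^ k + 1) + b * α ^ (i : ℕ)) := rfl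

theorem cyclicShift_traceWord {n k : ℕ} {α : F} (hα0 : α ≠ 0) (hα : α ^ n = 1) (a b : F) :
    cyclicShift (traceWord p n k α (a, b)) =
      traceWord p n k α ((α ^ (p ^ k + 1))⁻¹ * a, α⁻¹ * b) := by
  ext i
  obtain ⟨j, rfl⟩ := (finRotate n).surjective i
  rw [cyclicShift, Equiv.symm_apply_apply, traceWord_apply, traceWord_apply, pow_finRotate hα,
    pow_succ α j, mul_pow (α ^ (j : ℕ)) α]
  congr 2
  · field_simp
  · field_simp

/-- Multiplication by `X` is the cyclic shift, which scales `a` by `α ^ -(p ^ k + 1)` and `b` by `α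
^ -1`. Hence a polynomial `h` acts through its values at these two elements, and a common root
annihilates every trace word. -/
theorem mk_mul_wordClass_traceWord {n k : ℕ} {α : F} (hα0 : α ≠ 0) (hα : α ^ n = 1)
    (h : (ZMod p)[X]) (a b : F) :
    Ideal.Quotient.mk (Ideal.span {(X ^ n - 1 : (ZMod p)[X])}) h *
        wordClass n (traceWord p n k α (a, b)) =
      wordClass n (traceWord p n k α (aeval (α ^ (p ^ k + 1))⁻¹ h * a, aeval α⁻¹ h * b)) := by
  induction h using Polynomial.induction_on generalizing a b with
  | C c =>
    have : (aeval (α ^ (p ^ k + 1))⁻¹ (C c) * a, aeval α⁻¹ (C c) * b) = c • ((a, b) : F × F) := by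
      simp [Algebra.smul_def]
    rw [this, map_smul, map_smul, wordClass_apply, ← map_mul, ← smul_eq_C_mul]
    rfl
  | add f g hf hg =>
    rw [map_add, add_mul, hf, hg, ← map_add, ← map_add]
    simp [add_mul]
  | monomial j c ih =>
    have h1 : (C c * X ^ (j + 1) : (ZMod p)[X]) = C c * X ^ j * X := by rw [pow_succ, mul_assoc]
    rw [h1, map_mul _ _ X, mul_assoc, ← wordClass_cyclicShift, cyclicShift_traceWord hα0 hα, ih]
    simp only [map_mul, aeval_X, mul_assoc]

theorem traceWord_mem_codeOfParityCheck {n k : ℕ} (hn : 0 < n) {α : F} (hα0 : α ≠ 0)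
    (hα : α ^ n = 1) {h : (ZMod p)[X]} (hh : h ∣ X ^ n - 1)
    (h1 : aeval (α ^ (p ^ k + 1))⁻¹ h = 0) (h2 : aeval α⁻¹ h = 0) (ab : F × F) :
    traceWord p n k α ab ∈ codeOfParityCheck n h := by
  obtain ⟨a, b⟩ := ab
  rw [mem_codeOfParityCheck_iff hn hh, mk_mul_wordClass_traceWord hα0 hα, h1, h2, zero_mul,
    zero_mul, Prod.mk_zero_zero, map_zero, map_zero]

/-- The powers of `α` run once through the nonzero elements. The zero at `x = 0`, which is no
coordinate, accounts for `|F|` in place of `n = |F| - 1`. -/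
theorem hammingNorm_traceWord [Finite F] {n k : ℕ} (hF : Nat.card F = n + 1) {α : F}
    (hα : IsPrimitiveRoot α n) (a b : F) :
    (hammingNorm (traceWord p n k α (a, b)) : ℤ) = Nat.card F - pairZeros p k a b := by
  classical
  have hn : 0 < n := by
    have := Finite.one_lt_card (α := F)
    omega
  have hα0 : α ≠ 0 := hα.ne_zero hn.ne'
  have hbij : Function.Bijective fun i : Fin n => Units.mk0 α hα0 ^ (i : ℕ) := by
    rw [Nat.bijective_iff_injective_and_card]
    refine ⟨fun i j hij => ?_, by rw [Nat.card_units, hF, Nat.card_fin]; rfl⟩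
    have hij' : α ^ (i : ℕ) = α ^ (j : ℕ) := by simpa using congrArg Units.val hij
    exact Fin.ext (hα.pow_inj i.2 j.2 hij')
  have hz := card_subtype_eq_card_units
    (fun x : F => Algebra.trace (ZMod p) F (a * x ^ (p ^ k + 1) + b * x) = 0)
  rw [if_pos (by simp)] at hz
  have hcongr : Nat.card {i : Fin n // traceWord p n k α (a, b) i = 0} =
      Nat.card {u : Fˣ // Algebra.trace (ZMod p) F (a * (u : F) ^ (p ^ k + 1) + b * u) = 0} := by
    refine Nat.card_congr ((Equiv.ofBijective _ hbij).subtypeEquiv fun i => ?_)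
    simp [traceWord_apply]
  have hsplit : hammingNorm (traceWord p n k α (a, b)) +
      Nat.card {i : Fin n // traceWord p n k α (a, b) i = 0} = n := by
    rw [hammingNorm, Nat.card_eq_fintype_card, Fintype.card_subtype, add_comm,
      Finset.card_filter_add_card_filter_not, Finset.card_univ, Fintype.card_fin]
  rw [pairZeros, hz, hF, ← hcongr]
  push_cast
  omega

end TraceCode

/-! ### Parameters, dimension and weights of the code -/

/-- The valuation condition makes `m / d` even, hence `k / d` odd by coprimality. The case `t = 1`
would force `k = d` and `m = 2 k`. -/
theorem exists_parameters {m k d : ℕ} (hk : 0 < k) (hkm : k < m) (hd : d = Nat.gcd k m)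
    (hv : padicValNat 2 k + 1 ≤ padicValNat 2 m) (hm2k : m ≠ 2 * k) :
    ∃ e t, 0 < d ∧ 2 ≤ t ∧ k = d * (2 * e + 1) ∧ m = 2 * d * t ∧
      Nat.gcd (2 * d * t) (2 * (d * (2 * e + 1))) = 2 * d ∧
      padicValNat 2 m = padicValNat 2 k + 1 + padicValNat 2 t := by
  have hd0 : 0 < d := hd ▸ Nat.gcd_pos_of_pos_left _ hk
  obtain ⟨k', m', hcop, hk', hm'⟩ := Nat.exists_coprime k m
  rw [← hd] at hk' hm'
  have hk0 : k' ≠ 0 := by rintro rfl; omega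
  have hm0 : m' ≠ 0 := by rintro rfl; omega
  have hvk : padicValNat 2 k = padicValNat 2 k' + padicValNat 2 d := by
    rw [hk', padicValNat.mul hk0 hd0.ne']
  have hvm : padicValNat 2 m = padicValNat 2 m' + padicValNat 2 d := by
    rw [hm', padicValNat.mul hm0 hd0.ne']
  have h2m : 2 ∣ m' := dvd_of_one_le_padicValNat (by omega)
  have h2k : ¬ 2 ∣ k' := fun h => by
    have := Nat.dvd_gcd h h2m
    rw [hcop] at this
    omega
  have hvk' : padicValNat 2 k' = 0 := padicValNat.eq_zero_of_not_dvd h2k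
  obtain ⟨t, rfl⟩ := h2m
  obtain ⟨e, rfl⟩ : Odd k' := Nat.odd_iff.2 (by omega)
  have ht0 : t ≠ 0 := by rintro rfl; simp at hm0
  have hvt : padicValNat 2 (2 * t) = 1 + padicValNat 2 t := by
    rw [padicValNat.mul two_ne_zero ht0, padicValNat_self]
  refine ⟨e, t, hd0, ?_, by rw [hk', mul_comm], by rw [hm']; ring, ?_, by omega⟩
  · by_contra ht
    obtain rfl : t = 1 := by omega
    have : (2 * e + 1) < 2 * 1 := by
      by_contra hlt
      have := Nat.mul_le_mul_right d (not_lt.1 hlt)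
      omega
    obtain rfl : e = 0 := by omega
    omega
  · rw [show 2 * d * t = (2 * d) * t by ring, show 2 * (d * (2 * e + 1)) = (2 * d) * (2 * e + 1) by
      ring, Nat.gcd_mul_left]
    have : Nat.gcd t (2 * e + 1) = 1 :=
      (Nat.Coprime.coprime_dvd_right (dvd_mul_left t 2) hcop).symm
    rw [this, mul_one]

section

variable {p : ℕ} [Fact p.Prime] {F : Type*} [Field F] [Algebra (ZMod p) F]

/-- Because `p ^ d + 1` divides both `p ^ k + 1` and the order of `α`, the first element is a root
of `X ^ N - 1` with `N = (p ^ m - 1) / (p ^ d + 1)`. A common minimal polynomial would make `α`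
satisfy it as well, although its order is larger than `N`. -/
theorem minpoly_ne_minpoly {d e t : ℕ} (ht : 0 < d * t)
    {α : F} (hα : IsPrimitiveRoot α (p ^ (2 * d * t) - 1)) :
    minpoly (ZMod p) (α ^ (p ^ (d * (2 * e + 1)) + 1))⁻¹ ≠ minpoly (ZMod p) α⁻¹ := by
  intro h
  have hp1 : 1 < p := (Fact.out : p.Prime).one_lt
  have hn : 0 < p ^ (2 * d * t) - 1 :=
    Nat.sub_pos_of_lt (Nat.one_lt_pow (by rw [mul_assoc]; omega) hp1)
  obtain ⟨N, hN⟩ := prime_pow_add_one_dvd (d := d) (t := t) p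
  obtain ⟨M, hM⟩ : p ^ d + 1 ∣ p ^ (d * (2 * e + 1)) + 1 := by
    have := Odd.nat_add_dvd_pow_add_pow (p ^ d) 1 (n := 2 * e + 1) ⟨e, rfl⟩
    rwa [one_pow, ← pow_mul] at this
  have h1 : (α ^ (p ^ (d * (2 * e + 1)) + 1)) ^ N = 1 := by
    rw [← pow_mul, hM, mul_right_comm, ← hN, pow_mul, hα.pow_eq_one, one_pow]
  have h2 : minpoly (ZMod p) (α ^ (p ^ (d * (2 * e + 1)) + 1))⁻¹ ∣ X ^ N - 1 := by
    apply minpoly.dvd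
    simp [h1]
  rw [h] at h2
  have h3 := aeval_eq_zero_of_dvd_aeval_eq_zero h2 (minpoly.aeval (ZMod p) α⁻¹)
  have h4 : α ^ N = 1 := by
    simpa [sub_eq_zero] using h3
  have hp : 0 < p ^ d := pow_pos (by omega) d
  have hN0 : 0 < N := Nat.pos_of_ne_zero (by rintro rfl; omega)
  have h5 := Nat.le_of_dvd hN0 ((hα.pow_eq_one_iff_dvd N).1 h4)
  rw [hN] at h5
  nlinarith

theorem minpoly_dvd_X_pow_sub_one {n : ℕ} {x : F} (hx : x ^ n = 1) :
    minpoly (ZMod p) x ∣ X ^ n - 1 := by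
  apply minpoly.dvd
  simp [hx]

variable [Finite F]

theorem minpoly_mul_minpoly_dvd {n : ℕ} {x y : F} (hx : x ^ n = 1) (hy : y ^ n = 1)
    (hxy : minpoly (ZMod p) x ≠ minpoly (ZMod p) y) :
    minpoly (ZMod p) x * minpoly (ZMod p) y ∣ X ^ n - 1 := by
  have hxi : IsIntegral (ZMod p) x := Algebra.IsIntegral.isIntegral x
  have hyi : IsIntegral (ZMod p) y := Algebra.IsIntegral.isIntegral y
  refine IsCoprime.mul_dvd ?_ (minpoly_dvd_X_pow_sub_one hx) (minpoly_dvd_X_pow_sub_one hy)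
  rw [(minpoly.irreducible hxi).coprime_iff_not_dvd]
  intro h
  exact hxy (eq_of_monic_of_associated (minpoly.monic hxi) (minpoly.monic hyi)
    ((minpoly.irreducible hxi).associated_of_dvd (minpoly.irreducible hyi) h))

/-- A pair with zero word has `|F|` zeros, and `h1` says that only one pair does, namely `(0, 0)`.
-/
theorem traceWord_injective {n k : ℕ} (hF : Nat.card F = n + 1) {α : F}
    (hα : IsPrimitiveRoot α n) (h1 : pairCount p F k (Nat.card F) = 1) :
    Function.Injective (traceWord p n k α) := by
  rw [injective_iff_map_eq_zero]
  rintro ⟨a, b⟩ hab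
  have hnorm := hammingNorm_traceWord hF hα (p := p) (k := k) a b
  rw [hab, hammingNorm_zero] at hnorm
  obtain ⟨h, -⟩ := Nat.card_eq_one_iff_unique.1 h1
  have h0 : (pairZeros p k (0 : F) 0 : ℤ) = Nat.card F := by rw [pairZeros_zero_zero]
  have := h.elim ⟨(a, b), by push_cast at hnorm ⊢; omega⟩ ⟨(0, 0), h0⟩
  exact congrArg Subtype.val this

theorem codeOfParityCheck_eq_range {m k : ℕ} (hm : 0 < m) (hF : Nat.card F = p ^ m) {α : F}
    (hα : IsPrimitiveRoot α (p ^ m - 1)) (h1 : pairCount p F k (Nat.card F) = 1)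
    (hne : minpoly (ZMod p) (α ^ (p ^ k + 1))⁻¹ ≠ minpoly (ZMod p) α⁻¹) :
    minpoly (ZMod p) (α ^ (p ^ k + 1))⁻¹ * minpoly (ZMod p) α⁻¹ ∣ X ^ (p ^ m - 1) - 1 ∧
    codeOfParityCheck (p ^ m - 1)
        (minpoly (ZMod p) (α ^ (p ^ k + 1))⁻¹ * minpoly (ZMod p) α⁻¹) =
      LinearMap.range (traceWord p (p ^ m - 1) k α) ∧
    Module.finrank (ZMod p) (codeOfParityCheck (p ^ m - 1)
        (minpoly (ZMod p) (α ^ (p ^ k + 1))⁻¹ * minpoly (ZMod p) α⁻¹)) = 2 * m := by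
  have hp1 : 1 < p := (Fact.out : p.Prime).one_lt
  have hn : 0 < p ^ m - 1 := Nat.sub_pos_of_lt (Nat.one_lt_pow hm.ne' hp1)
  have hF' : Nat.card F = p ^ m - 1 + 1 := by omega
  have hdvd : minpoly (ZMod p) (α ^ (p ^ k + 1))⁻¹ * minpoly (ZMod p) α⁻¹ ∣
      X ^ (p ^ m - 1) - 1 := by
    apply minpoly_mul_minpoly_dvd _ _ hne
    · rw [inv_pow, ← pow_mul, mul_comm, pow_mul, hα.pow_eq_one, one_pow, inv_one]
    · rw [inv_pow, hα.pow_eq_one, inv_one]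
  have hfin : Module.finrank (ZMod p) F = m := by
    have := Module.natCard_eq_pow_finrank (K := ZMod p) (V := F)
    rw [hF, Nat.card_zmod] at this
    exact (Nat.pow_right_injective hp1 this).symm
  have hrange : Module.finrank (ZMod p) (LinearMap.range (traceWord p (p ^ m - 1) k α)) =
      2 * m := by
    rw [LinearMap.finrank_range_of_inj (traceWord_injective hF' hα h1), Module.finrank_prod, hfin,
      two_mul]
  have hle : LinearMap.range (traceWord p (p ^ m - 1) k α) ≤ codeOfParityCheck (p ^ m - 1)
      (minpoly (ZMod p) (α ^ (p ^ k + 1))⁻¹ * minpoly (ZMod p) α⁻¹) := by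
    rintro _ ⟨ab, rfl⟩
    exact traceWord_mem_codeOfParityCheck hn (hα.ne_zero hn.ne') hα.pow_eq_one hdvd
      (by rw [map_mul, minpoly.aeval, zero_mul]) (by rw [map_mul, minpoly.aeval, mul_zero]) ab
  have hdim : Module.finrank (ZMod p) (codeOfParityCheck (p ^ m - 1)
      (minpoly (ZMod p) (α ^ (p ^ k + 1))⁻¹ * minpoly (ZMod p) α⁻¹)) ≤ 2 * m := by
    -- Each minimal polynomial has degree at most `m`; the exact degrees are not needed, because the
    -- injective image of `F × F` already has dimension `2 m`.
    refine (finrank_codeOfParityCheck_le hn hdvd).trans (natDegree_mul_le.trans ?_)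
    have h2 := minpoly.natDegree_le (A := ZMod p) (α ^ (p ^ k + 1))⁻¹
    have h3 := minpoly.natDegree_le (A := ZMod p) α⁻¹
    omega
  have heq := Submodule.eq_of_le_of_finrank_le hle (hdim.trans hrange.ge)
  exact ⟨hdvd, heq.symm, by rw [← heq, hrange]⟩

theorem weightCount_range_traceWord {n k : ℕ} (hF : Nat.card F = n + 1) {α : F}
    (hα : IsPrimitiveRoot α n) (h1 : pairCount p F k (Nat.card F) = 1) (w : ℤ) :
    weightCount (LinearMap.range (traceWord p n k α)) w = pairCount p F k (Nat.card F - w) := by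
  have himg : {c : Fin n → ZMod p | c ∈ LinearMap.range (traceWord p n k α) ∧
      (hammingNorm c : ℤ) = w} = traceWord p n k α '' {ab : F × F |
        (pairZeros p k ab.1 ab.2 : ℤ) = Nat.card F - w} := by
    ext c
    constructor
    · rintro ⟨⟨⟨a, b⟩, rfl⟩, hw⟩
      refine ⟨(a, b), ?_, rfl⟩
      rw [hammingNorm_traceWord hF hα] at hw
      simp only [Set.mem_ofPred_eq]
      omega
    · rintro ⟨⟨a, b⟩, hab, rfl⟩
      refine ⟨⟨_, rfl⟩, ?_⟩
      simp only [Set.mem_ofPred_eq] at hab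
      rw [hammingNorm_traceWord hF hα]
      omega
  rw [weightCount, himg, Set.ncard_image_of_injective _ (traceWord_injective hF hα h1)]
  rfl

end

end CyclicCodes

end

open CyclicCodes in
theorem theorem1 (p m k d : ℕ) [Fact p.Prime] (hp : p ≠ 2)
    (hk : 0 < k) (hkm : k < m) (hd : d = Nat.gcd k m)
    (hv : padicValNat 2 k + 1 ≤ padicValNat 2 m) (hm2k : m ≠ 2 * k)
    {F : Type*} [Field F] [Algebra (ZMod p) F] (hF : Nat.card F = p ^ m)
    (α : F) (hα : IsPrimitiveRoot α (p ^ m - 1))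
    (h₁ h₂ : Polynomial (ZMod p))
    (hh₁ : h₁ = minpoly (ZMod p) (α ^ (-((p : ℤ) ^ k + 1))))
    (hh₂ : h₂ = minpoly (ZMod p) (α ^ (-1 : ℤ)))
    (C₁ : Submodule (ZMod p) (Fin (p ^ m - 1) → ZMod p))
    (hC₁ : C₁ = codeOfParityCheck (p ^ m - 1) (h₁ * h₂))
    (A : ℤ → ℕ) (hA : A = weightCount C₁) :
    h₁ * h₂ ∣ Polynomial.X ^ (p ^ m - 1) - 1 ∧
    IsCyclicCode C₁ ∧
    Module.finrank (ZMod p) C₁ = 2 * m ∧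
    (padicValNat 2 m = padicValNat 2 k + 1 →
      A 0 = 1 ∧
      (A ((p - 1) * p ^ (m - 1)) : ℚ)
        = (p ^ m - 1) * (1 + p ^ (m - d) - p ^ (m - 2 * d)) ∧
      (A ((p - 1) * (p ^ (m - 1) + p ^ ((m - 2) / 2))) : ℚ)
        = (p ^ (m - 1) - (p - 1) * p ^ ((m - 2) / 2)) * (p ^ d * (p ^ m - 1) / (p ^ d + 1)) ∧
      (A ((p - 1) * p ^ (m - 1) - p ^ ((m - 2) / 2)) : ℚ)
        = (p - 1) * (p ^ (m - 1) + p ^ ((m - 2) / 2)) * (p ^ d * (p ^ m - 1) / (p ^ d + 1)) ∧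
      (A ((p - 1) * (p ^ (m - 1) - p ^ ((m + 2 * d - 2) / 2))) : ℚ)
        = (p ^ (m - 2 * d - 1) + (p - 1) * p ^ ((m - 2 * d - 2) / 2))
            * ((p ^ m - 1) / (p ^ d + 1)) ∧
      (A ((p - 1) * p ^ (m - 1) + p ^ ((m + 2 * d - 2) / 2)) : ℚ)
        = (p - 1) * (p ^ (m - 2 * d - 1) - p ^ ((m - 2 * d - 2) / 2))
            * ((p ^ m - 1) / (p ^ d + 1)) ∧
      ∀ w : ℤ, w ∉ ({0, ((p : ℤ) - 1) * p ^ (m - 1),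
          ((p : ℤ) - 1) * (p ^ (m - 1) + p ^ ((m - 2) / 2)),
          ((p : ℤ) - 1) * p ^ (m - 1) - p ^ ((m - 2) / 2),
          ((p : ℤ) - 1) * (p ^ (m - 1) - p ^ ((m + 2 * d - 2) / 2)),
          ((p : ℤ) - 1) * p ^ (m - 1) + p ^ ((m + 2 * d - 2) / 2)} : Set ℤ) → A w = 0) ∧
    (padicValNat 2 k + 1 < padicValNat 2 m →
      A 0 = 1 ∧
      (A ((p - 1) * p ^ (m - 1)) : ℚ)
        = (p ^ m - 1) * (1 + p ^ (m - d) - p ^ (m - 2 * d)) ∧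
      (A ((p - 1) * (p ^ (m - 1) - p ^ ((m - 2) / 2))) : ℚ)
        = (p ^ (m - 1) + (p - 1) * p ^ ((m - 2) / 2)) * (p ^ d * (p ^ m - 1) / (p ^ d + 1)) ∧
      (A ((p - 1) * p ^ (m - 1) + p ^ ((m - 2) / 2)) : ℚ)
        = (p - 1) * (p ^ (m - 1) - p ^ ((m - 2) / 2)) * (p ^ d * (p ^ m - 1) / (p ^ d + 1)) ∧
      (A ((p - 1) * (p ^ (m - 1) + p ^ ((m + 2 * d - 2) / 2))) : ℚ)
        = (p ^ (m - 2 * d - 1) - (p - 1) * p ^ ((m - 2 * d - 2) / 2))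
            * ((p ^ m - 1) / (p ^ d + 1)) ∧
      (A ((p - 1) * p ^ (m - 1) - p ^ ((m + 2 * d - 2) / 2)) : ℚ)
        = (p - 1) * (p ^ (m - 2 * d - 1) + p ^ ((m - 2 * d - 2) / 2))
            * ((p ^ m - 1) / (p ^ d + 1)) ∧
      ∀ w : ℤ, w ∉ ({0, ((p : ℤ) - 1) * p ^ (m - 1),
          ((p : ℤ) - 1) * (p ^ (m - 1) - p ^ ((m - 2) / 2)),
          ((p : ℤ) - 1) * p ^ (m - 1) + p ^ ((m - 2) / 2),
          ((p : ℤ) - 1) * (p ^ (m - 1) + p ^ ((m + 2 * d - 2) / 2)),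
          ((p : ℤ) - 1) * p ^ (m - 1) - p ^ ((m + 2 * d - 2) / 2)} : Set ℤ) → A w = 0) := by
  have hp0 : 0 < p := (Fact.out : p.Prime).pos
  have hfin : Finite F := Nat.finite_of_card_ne_zero (by rw [hF]; positivity)
  obtain ⟨e, t, hd0, ht, hke, hmt, hg, hvt⟩ := exists_parameters hk hkm hd hv hm2k
  have ht0 : t ≠ 0 := by omega
  clear hd hv hm2k hkm
  have hzp : α ^ (-((p : ℤ) ^ k + 1)) = (α ^ (p ^ k + 1))⁻¹ := by
    rw [zpow_neg]
    exact_mod_cast rfl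
  rw [hzp] at hh₁
  rw [zpow_neg_one] at hh₂
  have hr : 2 * d ≤ d * t := by nlinarith
  have hm2 : m = 2 * (d * t) := by rw [hmt]; ring
  have hm0 : 0 < m := by omega
  have hF' : Nat.card F = p ^ m - 1 + 1 := by
    have : 0 < p ^ m := pow_pos hp0 m
    omega
  have hFq : (Nat.card F : ℤ) = p * p ^ (m - 1) := by
    rw [hF, ← pow_succ', Nat.sub_add_cancel hm0]
    push_cast
    rfl
  obtain ⟨hM0, hM1, hM2, hM3, hM4, hM5, hM6⟩ := pairCount_eq (e := e) (t := t) (F := F) hp hd0 ht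
    hg (by rw [hF, hmt]) rfl rfl rfl
  rw [← hke, ← hmt] at hM0 hM1 hM2 hM3 hM4 hM5 hM6
  have hone : pairCount p F k (Nat.card F) = 1 := by
    rw [hFq]
    exact_mod_cast hM0
  have hne : minpoly (ZMod p) (α ^ (p ^ k + 1))⁻¹ ≠ minpoly (ZMod p) α⁻¹ := by
    rw [hke]
    exact minpoly_ne_minpoly (by omega) (hmt ▸ hα)
  obtain ⟨hdvd, hrange, hdim⟩ := codeOfParityCheck_eq_range hm0 hF hα hone hne
  rw [← hh₁, ← hh₂] at hdvd hrange hdim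
  rw [← hC₁] at hrange hdim
  have hAw (w : ℤ) : A w = pairCount p F k (p * p ^ (m - 1) - w) := by
    rw [hA, hrange, weightCount_range_traceWord hF' hα hone, hFq]
  -- Since `m = 2 d t` with `t ≥ 2`, the halvings are exact and no subtraction is truncated, here
  -- and in the exponents below.
  have e1 : (m - 2) / 2 = d * t - 1 := by omega
  have e2 : (m + 2 * d - 2) / 2 = d * t - 1 + d := by omega
  have hpQ : (p : ℚ) ≠ 0 := by exact_mod_cast hp0.ne'
  have hD : (p : ℚ) ^ d ≠ 0 := pow_ne_zero _ hpQ
  have hD1 : (p : ℚ) ^ d + 1 ≠ 0 := by positivity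
  have f1 : (p : ℚ) ^ m = p * p ^ (m - 1) := by rw [← pow_succ', Nat.sub_add_cancel hm0]
  have f2 : (p : ℚ) ^ (m - d) = p * p ^ (m - 1) / p ^ d := by
    rw [eq_div_iff hD, ← pow_add, ← f1]; congr 1; omega
  have f3 : (p : ℚ) ^ (m - 2 * d) = p * p ^ (m - 1) / (p ^ d) ^ 2 := by
    rw [eq_div_iff (pow_ne_zero 2 hD), ← pow_mul, ← pow_add, ← f1]; congr 1; omega
  have f4 : (p : ℚ) ^ (m - 2 * d - 1) = p ^ (m - 1) / (p ^ d) ^ 2 := by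
    rw [eq_div_iff (pow_ne_zero 2 hD), ← pow_mul, ← pow_add]; congr 1; omega
  have f5 : (p : ℚ) ^ ((m - 2 * d - 2) / 2) = p ^ (d * t - 1) / p ^ d := by
    rw [eq_div_iff hD, ← pow_add]; congr 1; omega
  have hA0 : A 0 = 1 := by
    rw [hAw, sub_zero]
    exact_mod_cast hM0
  have hAv {w v : ℤ} {c : ℚ} (hM : (pairCount p F k v : ℚ) = c)
      (hwv : w = p * p ^ (m - 1) - v) : (A w : ℚ) = c := by
    rw [hAw, hwv, sub_sub_cancel, hM]
  have hA1 : (A ((p - 1) * p ^ (m - 1)) : ℚ)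
        = (p ^ m - 1) * (1 + p ^ (m - d) - p ^ (m - 2 * d)) := by
    rw [hAv hM1 (by ring), f1, f2, f3]
    push_cast
    field_simp
    ring
  rw [e1, e2, f4, f5]
  refine ⟨hdvd, ?_, hdim, fun hv => ?_, fun hv => ?_⟩
  · rw [hC₁]
    exact isCyclicCode_codeOfGenerator _
  · have hodd : Odd t := by
      rw [← Nat.not_even_iff_odd, even_iff_two_dvd]
      intro h
      have := one_le_padicValNat_of_dvd ht0 h
      omega
    rw [hodd.neg_one_pow] at hM2 hM3 hM4 hM5 hM6
    refine ⟨hA0, hA1, ?_, ?_, ?_, ?_, fun w hw => ?_⟩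
    · rw [hAv hM2 (by ring), f1]
      push_cast
      ring
    · rw [hAv hM3 (by ring), f1]
      push_cast
      ring
    · rw [hAv hM4 (by ring), f1]
      push_cast
      field_simp
    · rw [hAv hM5 (by ring), f1]
      push_cast
      field_simp
    · simp only [Set.mem_insert_iff, Set.mem_singleton_iff, not_or] at hw
      obtain ⟨w0, w1, w2, w3, w4, w5⟩ := hw
      rw [hAw]
      apply hM6
      · contrapose! w0; linear_combination - w0
      · contrapose! w1; linear_combination - w1
      · contrapose! w2; linear_combination - w2
      · contrapose! w3; linear_combination - w3
      · contrapose! w4; linear_combination - w4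
      · contrapose! w5; linear_combination - w5
  · have heven : Even t := by
      rw [even_iff_two_dvd]
      exact dvd_of_one_le_padicValNat (by omega)
    rw [heven.neg_one_pow] at hM2 hM3 hM4 hM5 hM6
    refine ⟨hA0, hA1, ?_, ?_, ?_, ?_, fun w hw => ?_⟩
    · rw [hAv hM2 (by ring), f1]
      push_cast
      ring
    · rw [hAv hM3 (by ring), f1]
      push_cast
      ring
    · rw [hAv hM4 (by ring), f1]
      push_cast
      field_simp
      ring
    · rw [hAv hM5 (by ring), f1]
      push_cast
      field_simp
      ring
    · simp only [Set.mem_insert_iff, Set.mem_singleton_iff, not_or] at hw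
      obtain ⟨w0, w1, w2, w3, w4, w5⟩ := hw
      rw [hAw]
      apply hM6
      · contrapose! w0; linear_combination - w0
      · contrapose! w1; linear_combination - w1
      · contrapose! w2; linear_combination - w2
      · contrapose! w3; linear_combination - w3
      · contrapose! w4; linear_combination - w4
      · contrapose! w5; linear_combination - w5
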